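/- **Notation.** Let $n\ge 1$. For a measurable $g:\mathbb R^n\to\mathbb C$ put $\mu_g(\alpha)=|\{x\in\mathbb R^n: |g(x)|>\alpha\}|$ and, for $1\le p,q\le\infty$, $$\|g\|_{L^{p,q}}=\begin{cases}\left(p\int_0^\infty[\alpha\,\mu_g(\alpha)^{1/p}]^q\frac{d\alpha}{\alpha}\right)^{1/q}& p,q<\infty,\\ \sup_{\alpha>0}\alpha\,\mu_g(\alpha)^{1/p}& p<\infty,\ q=\infty,\\ \inf\{\alpha>0:\mu_g(\alpha)=0\}& p=q=\infty,\end{cases}$$ with $L^{\infty,q}=\{0\}$ for $q<\infty$. Let $\psi=\{\psi_j\}_{j\ge0}\subset C_c^\infty(\mathbb R^n)$ satisfy $\operatorname{supp}\psi_0\subset\{|\xi|\le2\}$, $\operatorname{supp}\psi_j\subset\{2^{j-1}\le|\xi|\le2^{j+1}\}$ for $j\ge1$, $\sup_{j,\xi}2^{j|\alpha|}|D^\alpha\psi_j(\xi)|<\infty$ for every multi-index $\alpha$, and $\sum_{j\ge0}\psi_j(\xi)=1$ for every $\xi\in\mathbb R^n$. For a tempered distribution $f$ let $\Delta_jf=(\psi_j\hat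 f)^\vee=\psi_j^\vee*f$. For $s\in\mathbb R$ and $1\le p,q,r\le\infty$, the inhomogeneous Besov–Lorentz space $B^{s,r}_{p,q}$ consists of all tempered distributions $f$ on $\mathbb R^n$ with $$\|f\|_{B^{s,r}_{p,q}}=\Big\|\big\{2^{js}\|\Delta_jf\|_{L^{p,q}}\big\}_{j\ge0}\Big\|_{\ell^r}<\infty .$$ **Theorem.** Let $s,s_1,s_2\in\mathbb R$, $1\le p,p_1,p_2,q,q_1,q_2,r,r_1,r_2\le\infty$ and $0<\theta<1$. Assume that $q=\infty$ if $p=\infty$, and that $q_i=\infty$ if $p_i=\infty$ ($i=1,2$). Put $$s_*=(1-\theta)s_1+\theta s_2,\qquad \frac1{p_*}=\frac{1-\theta}{p_1}+\frac{\theta}{p_2},\qquad \frac1{q_*}=\frac{1-\theta}{q_1}+\frac{\theta}{q_2},\qquad \frac1{r_*}=\frac{1-\theta}{r_1}+\frac{\theta}{r_2},$$ and assume $$s_*-s\ \ge\ \frac n{p_*}-\frac np\ \ge\ 0 .$$ If one of the following conditions is satisfied: 1. (i) $q_*\le q$, $r_*\le r$; 2. (ii) $p_*=p$, $p_1\ne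 p_2$, $r_*\le r$; 3. (iii) $p_*<p$, $r_*\le r$; 4. (iv) $s_1\ne s_2$, $p=p_1=p_2$, $\max(q_1,q_2)\le q$; 5. (v) $s_*>s$, $p_*=p$, $q_*\le q$; 6. (vi) $s_*>s$, $p_*=p$, $p_1\ne p_2$; 7. (vii) $s_*-s>n/p_*-n/p>0$; 8. (viii) $s_*-s=n/p_*-n/p>0$, $s_2-s_1\ne n/p_2-n/p_1$; then there is a constant $C$, independent of $f$, such that $$\|f\|_{B^{s,r}_{p,q}}\le C\,\|f\|_{B^{s_1,r_1}_{p_1,q_1}}^{1-\theta}\,\|f\|_{B^{s_2,r_2}_{p_2,q_2}}^{\theta}\qquad\text{for all } f\in B^{s_1,r_1}_{p_1,q_1}\cap B^{s_2,r_2}_{p_2,q_2}.$$ -/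

import Mathlib

open MeasureTheory Set
open scoped ENNReal SchwartzMap FourierTransform

noncomputable section

/-- The Euclidean space `ℝⁿ`. -/
abbrev Rn (n : ℕ) : Type := EuclideanSpace ℝ (Fin n)

/-- Distribution function `μ_g(α) = |{x ∈ ℝⁿ : |g(x)| > α}|`. -/
def distribFun {n : ℕ} (g : Rn n → ℂ) (α : ℝ) : ℝ≥0∞ :=
  volume {x : Rn n | α < ‖g x‖}

/-- The Lorentz quasi-norm `‖g‖_{L^{p,q}}`, with value `∞` when `g ∉ L^{p,q}`.
The space `L^{∞,q}` with `q < ∞` is `{0}`, modulo equality almost everywhere. -/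
def lorentzNorm {n : ℕ} (p q : ℝ≥0∞) (g : Rn n → ℂ) : ℝ≥0∞ :=
  open scoped Classical in
  if p = ∞ then
    if q = ∞ then
      ⨅ (α : ℝ) (_ : 0 < α ∧ distribFun g α = 0), ENNReal.ofReal α
    else
      if distribFun g 0 = 0 then 0 else ∞
  else
    if q = ∞ then
      ⨆ (α : ℝ) (_ : 0 < α), ENNReal.ofReal α * distribFun g α ^ (1 / p.toReal)
    else
      (p * ∫⁻ α in Ioi (0 : ℝ),
        (ENNReal.ofReal α * distribFun g α ^ (1 / p.toReal)) ^ q.toReal / ENNReal.ofReal α)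
          ^ (1 / q.toReal)

/-- The `ℓ^r` norm of a sequence of extended nonnegative numbers. -/
def seqNorm (r : ℝ≥0∞) (a : ℕ → ℝ≥0∞) : ℝ≥0∞ :=
  open scoped Classical in
  if r = ∞ then ⨆ j, a j else (∑' j, a j ^ r.toReal) ^ (1 / r.toReal)

/-- An inhomogeneous dyadic resolution of unity `ψ = (ψ_j)_{j ≥ 0}` in `C_c^∞(ℝⁿ)`.
The functions are given as Schwartz functions; the support conditions make them compactly
supported, and every function in `C_c^∞(ℝⁿ)` is a Schwartz function. Bounding all `D^α ψ_j` with
`|α| = k` is the same as bounding the norm of the `k`-th Fréchet derivative. -/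
structure IsDyadicResolution {n : ℕ} (ψ : ℕ → 𝓢(Rn n, ℂ)) : Prop where
  supp_zero : tsupport (ψ 0 : Rn n → ℂ) ⊆ {ξ | ‖ξ‖ ≤ 2}
  supp_pos : ∀ j : ℕ, 1 ≤ j →
    tsupport (ψ j : Rn n → ℂ) ⊆ {ξ | (2 : ℝ) ^ ((j : ℝ) - 1) ≤ ‖ξ‖ ∧ ‖ξ‖ ≤ 2 ^ ((j : ℝ) + 1)}
  deriv_bound : ∀ k : ℕ, ∃ C : ℝ, ∀ (j : ℕ) (ξ : Rn n),
    (2 : ℝ) ^ (j * k) * ‖iteratedFDeriv ℝ k (ψ j : Rn n → ℂ) ξ‖ ≤ C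
  sum_eq_one : ∀ ξ : Rn n, HasSum (fun j => ψ j ξ) 1

/-- The Schwartz function `y ↦ φ(x - y)`. -/
def reflectTranslate {n : ℕ} (φ : 𝓢(Rn n, ℂ)) (x : Rn n) : 𝓢(Rn n, ℂ) :=
  SchwartzMap.compCLMOfAntilipschitz ℂ (g := fun y : Rn n => x - y) (K := 1) (by fun_prop)
    (fun _ _ => by simp [edist_dist, dist_eq_norm, norm_sub_rev]) φ

theorem reflectTranslate_apply {n : ℕ} (φ : 𝓢(Rn n, ℂ)) (x y : Rn n) :
    reflectTranslate φ x y = φ (x - y) := rfl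

/-- The Littlewood–Paley piece `Δ_j f = (ψ_j f̂)^∨ = ψ_j^∨ * f` of a tempered distribution `f`. It
is a smooth function on `ℝⁿ`, namely `x ↦ ⟨f, ψ_j^∨(x - ·)⟩`. -/
def lpPiece {n : ℕ} (ψ : ℕ → 𝓢(Rn n, ℂ)) (j : ℕ) (f : 𝓢'(Rn n, ℂ)) (x : Rn n) : ℂ :=
  f (reflectTranslate (𝓕⁻ (ψ j)) x)

/-- The inhomogeneous Besov–Lorentz quasi-norm
`‖f‖_{B^{s,r}_{p,q}} = ‖(2^{js} ‖Δ_j f‖_{L^{p,q}})_{j ≥ 0}‖_{ℓ^r}`, with value `∞` when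
`f` is not in the space. -/
def besovLorentzNorm {n : ℕ} (ψ : ℕ → 𝓢(Rn n, ℂ)) (s : ℝ) (p q r : ℝ≥0∞)
    (f : 𝓢'(Rn n, ℂ)) : ℝ≥0∞ :=
  seqNorm r fun j => (2 : ℝ≥0∞) ^ ((j : ℝ) * s) * lorentzNorm p q (lpPiece ψ j f)

/-- The inhomogeneous Besov–Lorentz space `B^{s,r}_{p,q}`. -/
def besovLorentzSpace {n : ℕ} (ψ : ℕ → 𝓢(Rn n, ℂ)) (s : ℝ) (p q r : ℝ≥0∞) :
    Set 𝓢'(Rn n, ℂ) :=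
  {f | besovLorentzNorm ψ s p q r f < ∞}

/-- The exponent `a_*` with `1/a_* = (1-θ)/a₁ + θ/a₂`, where `1/∞ = 0`. -/
def interpExp (θ : ℝ) (a₁ a₂ : ℝ≥0∞) : ℝ≥0∞ :=
  (ENNReal.ofReal (1 - θ) * a₁⁻¹ + ENNReal.ofReal θ * a₂⁻¹)⁻¹

/-- The number `n/a`, with `n/∞ = 0`. -/
def dimOver (n : ℕ) (a : ℝ≥0∞) : ℝ := n * (a⁻¹).toReal

end

/-! The inequality is proved one frequency block at a time and then summed over `j`. Write `d = s -
n/p` and `dᵢ = sᵢ - n/pᵢ`. For each block, `‖Δ_j f‖_{p,q} ≤ C 2^{jn(1/p_* - 1/p)} ‖Δ_j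
f‖_{p₁,q₁}^{1-θ} ‖Δ_j f‖_{p₂,q₂}^θ` (`exists_block_bound`). If `p_* < p`, two weak-type bounds
combine into a weak `L^{p_*}` bound, and Nikolskii's inequality raises the integrability. If `p_* =
p` and `p₁ ≠ p₂`, real interpolation of weak bounds gives every `q` (`lorentzNorm_le_of_weakBound`).
If `p_* = p` and `p₁ = p₂`, Hölder in the second index is used, which is why `q_* ≤ q` is needed
there.

After weighting by `2^{js}` the block estimate carries the factor `2^{je}` with `e = (n/p_* - n/p) -
(s_* - s) ≤ 0`. There are three ways to sum. If `r_* ≤ r`, drop the factor and apply Hölder in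
`ℓ^r`. If `e < 0`, sum a geometric series. Otherwise use the block estimate at both `θ - ε` and `θ +
ε`: the factors become `2^{±jεD}` with `D = d₂ - d₁ ≠ 0`, and the smaller of the two bounds is
summable uniformly in `f` (`exists_tsum_le_interp`).

Nikolskii's inequality for tempered distributions rests on the reproducing formula `Δ_j f = Δ_j f *
Φ_j` (`apply_reflectTranslate_reproducing`) and on an absorption argument (`le_of_le_convolution`)
that passes directly from weak `L^p` to `L^∞`. -/

noncomputable section

/-! ### Hölder and nesting, shared by `ℓ^r` (counting measure) and Lorentz norms (`dα/α`). -/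

/-- The `L^r(ν)` quasi-norm of an `ℝ≥0∞`-valued function, with a genuine supremum for `r = ∞`. -/
def supNorm {X : Type*} [MeasurableSpace X] (ν : Measure X) (r : ℝ≥0∞) (h : X → ℝ≥0∞) : ℝ≥0∞ :=
  open scoped Classical in
  if r = ∞ then ⨆ x, h x else (∫⁻ x, h x ^ r.toReal ∂ν) ^ (1 / r.toReal)

section supNorm

variable {X : Type*} [MeasurableSpace X] {ν : Measure X} {h a b : X → ℝ≥0∞}

theorem supNorm_top : supNorm ν ∞ h = ⨆ x, h x := by simp [supNorm]

theorem supNorm_of_ne_top {r : ℝ≥0∞} (hr : r ≠ ∞) :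
    supNorm ν r h = (∫⁻ x, h x ^ r.toReal ∂ν) ^ (1 / r.toReal) := by simp [supNorm, hr]

theorem supNorm_mono (r : ℝ≥0∞) (hab : ∀ x, a x ≤ b x) : supNorm ν r a ≤ supNorm ν r b := by
  unfold supNorm
  split_ifs
  · exact iSup_mono hab
  · gcongr with x
    exact hab x

theorem supNorm_const_mul {r : ℝ≥0∞} (hr : 1 ≤ r) {c : ℝ≥0∞} (hc : c ≠ ∞) :
    supNorm ν r (fun x => c * h x) = c * supNorm ν r h := by
  unfold supNorm
  split_ifs with h1
  · rw [ENNReal.mul_iSup]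
  · have hr0 : 0 < r.toReal := ENNReal.toReal_pos (by positivity) h1
    simp_rw [ENNReal.mul_rpow_of_nonneg _ _ hr0.le]
    rw [lintegral_const_mul' _ _ (by simp [hr0.le, hc]), ENNReal.mul_rpow_of_nonneg _ _ (by positivity),
      ← ENNReal.rpow_mul, mul_one_div_cancel hr0.ne', ENNReal.rpow_one]

theorem toReal_ge_one {r : ℝ≥0∞} (hr : 1 ≤ r) (h1 : r ≠ ∞) : 1 ≤ r.toReal := by
  simpa using ENNReal.toReal_mono h1 hr

theorem interpExp_inv (θ : ℝ) (r₁ r₂ : ℝ≥0∞) : (interpExp θ r₁ r₂)⁻¹ =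
    ENNReal.ofReal (1 - θ) * r₁⁻¹ + ENNReal.ofReal θ * r₂⁻¹ := by
  simp [interpExp]

theorem interpExp_inv_toReal {θ : ℝ} (h0 : 0 ≤ θ) (h1 : θ ≤ 1) {r₁ r₂ : ℝ≥0∞} (hr₁ : 1 ≤ r₁)
    (hr₂ : 1 ≤ r₂) : ((interpExp θ r₁ r₂)⁻¹).toReal =
      (1 - θ) * (r₁⁻¹).toReal + θ * (r₂⁻¹).toReal := by
  have e1 : r₁⁻¹ ≠ ∞ := by simp; positivity
  have e2 : r₂⁻¹ ≠ ∞ := by simp; positivity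
  rw [interpExp_inv, ENNReal.toReal_add (ENNReal.mul_ne_top (by simp) e1)
    (ENNReal.mul_ne_top (by simp) e2), ENNReal.toReal_mul, ENNReal.toReal_mul,
    ENNReal.toReal_ofReal h0, ENNReal.toReal_ofReal (by linarith)]

theorem one_le_interpExp {θ : ℝ} (h0 : 0 ≤ θ) (h1 : θ ≤ 1) {r₁ r₂ : ℝ≥0∞} (hr₁ : 1 ≤ r₁)
    (hr₂ : 1 ≤ r₂) : 1 ≤ interpExp θ r₁ r₂ := by
  unfold interpExp
  rw [ENNReal.one_le_inv]
  calc _ ≤ ENNReal.ofReal (1 - θ) * 1 + ENNReal.ofReal θ * 1 := by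
        gcongr <;> simpa
    _ = 1 := by
        rw [mul_one, mul_one, ← ENNReal.ofReal_add (by linarith) h0]; simp

theorem interpExp_top_left {θ : ℝ} (r₂ : ℝ≥0∞) (h : 0 < θ) :
    interpExp θ ∞ r₂ = r₂ / ENNReal.ofReal θ := by
  simp only [interpExp, ENNReal.inv_top, mul_zero, zero_add]
  rw [ENNReal.mul_inv (by simp [h]) (by simp), inv_inv, mul_comm, ENNReal.div_eq_inv_mul, mul_comm]

theorem interpExp_symm (θ : ℝ) (r₁ r₂ : ℝ≥0∞) :
    interpExp (1 - θ) r₂ r₁ = interpExp θ r₁ r₂ := by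
  simp [interpExp, add_comm]

theorem toReal_inv_eq_one_div (r : ℝ≥0∞) : (r⁻¹).toReal = 1 / r.toReal := by
  rw [ENNReal.toReal_inv, one_div]

theorem interpExp_eq_top {θ : ℝ} (h0 : 0 < θ) (h1 : θ < 1) {r₁ r₂ : ℝ≥0∞} :
    interpExp θ r₁ r₂ = ∞ ↔ r₁ = ∞ ∧ r₂ = ∞ := by
  rw [← ENNReal.inv_eq_zero, interpExp_inv]
  simp [h0.not_ge, h1.not_ge]

/-- Here `r_* = r₂/θ`, so raising to the power `r_*` turns `b^θ` into `b^{r₂}`, while `a` leaves the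
integral through its supremum. -/
theorem supNorm_interp_top_left {θ : ℝ} (h0 : 0 < θ) (h1 : θ < 1) {r₂ : ℝ≥0∞}
    (hr₂ : 1 ≤ r₂) (hf : r₂ ≠ ∞) (hb : Measurable b)
    (hab : ∀ x, h x ≤ a x ^ (1 - θ) * b x ^ θ) :
    supNorm ν (interpExp θ ∞ r₂) h ≤ supNorm ν ∞ a ^ (1 - θ) * supNorm ν r₂ b ^ θ := by
  have hr0 : 0 < r₂.toReal := by linarith [toReal_ge_one hr₂ hf]
  have hne : interpExp θ ∞ r₂ ≠ ∞ := by simp [interpExp_eq_top h0 h1, hf]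
  have htr : (interpExp θ ∞ r₂).toReal = r₂.toReal / θ := by
    rw [interpExp_top_left _ h0, ENNReal.toReal_div, ENNReal.toReal_ofReal h0.le]
  rw [supNorm_of_ne_top hne, supNorm_of_ne_top hf, supNorm_top, htr]
  set A := ⨆ x, a x
  have hθ : 0 ≤ 1 - θ := by linarith
  set ρ := r₂.toReal / θ with hρ
  have hρ0 : 0 < ρ := by positivity
  have key : ∫⁻ x, h x ^ ρ ∂ν ≤ A ^ ((1 - θ) * ρ) * ∫⁻ x, b x ^ r₂.toReal ∂ν := by
    rw [← lintegral_const_mul _ (hb.pow_const _)]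
    refine lintegral_mono fun x => ?_
    calc h x ^ ρ ≤ (A ^ (1 - θ) * b x ^ θ) ^ ρ := by
          gcongr
          refine (hab x).trans ?_
          gcongr
          exact le_iSup a x
      _ = _ := by
          rw [ENNReal.mul_rpow_of_nonneg _ _ hρ0.le, ← ENNReal.rpow_mul, ← ENNReal.rpow_mul]
          congr 2
          rw [hρ]; field_simp
  calc _ ≤ (A ^ ((1 - θ) * ρ) * ∫⁻ x, b x ^ r₂.toReal ∂ν) ^ (1 / ρ) := by gcongr
    _ = _ := by
      rw [ENNReal.mul_rpow_of_nonneg _ _ (by positivity), ← ENNReal.rpow_mul, ← ENNReal.rpow_mul]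
      congr 2
      · field_simp
      · rw [hρ]; field_simp

/-- Hölder's inequality with weights `(1-θ)r_*/r₁` and `θr_*/r₂`, which sum to one by the definition
of `r_*`. Infinite exponents are treated apart. -/
theorem supNorm_interp {θ : ℝ} (h0 : 0 < θ) (h1 : θ < 1) {r₁ r₂ : ℝ≥0∞}
    (hr₁ : 1 ≤ r₁) (hr₂ : 1 ≤ r₂) (ha : Measurable a) (hb : Measurable b)
    (hab : ∀ x, h x ≤ a x ^ (1 - θ) * b x ^ θ) :
    supNorm ν (interpExp θ r₁ r₂) h ≤ supNorm ν r₁ a ^ (1 - θ) * supNorm ν r₂ b ^ θ := by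
  have hθ : 0 < 1 - θ := by linarith
  by_cases hf₁ : r₁ = ∞
  · subst hf₁
    by_cases hf₂ : r₂ = ∞
    · subst hf₂
      rw [(interpExp_eq_top h0 h1).2 ⟨rfl, rfl⟩, supNorm_top, supNorm_top, supNorm_top]
      refine iSup_le fun x => (hab x).trans ?_
      gcongr
      · exact le_iSup a x
      · exact le_iSup b x
    · exact supNorm_interp_top_left h0 h1 hr₂ hf₂ hb hab
  by_cases hf₂ : r₂ = ∞
  · subst hf₂
    rw [← interpExp_symm, mul_comm]
    have := supNorm_interp_top_left (ν := ν) (h := h) (a := b) (b := a) hθ (by linarith) hr₁ hf₁ ha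
      (fun x => by simpa [mul_comm] using hab x)
    simpa using this
  have hp₁ : 0 < r₁.toReal := by linarith [toReal_ge_one hr₁ hf₁]
  have hp₂ : 0 < r₂.toReal := by linarith [toReal_ge_one hr₂ hf₂]
  have hne : interpExp θ r₁ r₂ ≠ ∞ := by simp [interpExp_eq_top h0 h1, hf₁]
  have h1r := one_le_interpExp h0.le h1.le hr₁ hr₂
  have hinv := interpExp_inv_toReal h0.le h1.le hr₁ hr₂
  rw [supNorm_of_ne_top hne, supNorm_of_ne_top hf₁, supNorm_of_ne_top hf₂]
  simp only [toReal_inv_eq_one_div] at hinv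
  set ρ := (interpExp θ r₁ r₂).toReal
  have hρ0 : 0 < ρ := by linarith [toReal_ge_one h1r hne]
  have key : ∫⁻ x, h x ^ ρ ∂ν ≤ (∫⁻ x, a x ^ r₁.toReal ∂ν) ^ ((1 - θ) * ρ / r₁.toReal) *
      (∫⁻ x, b x ^ r₂.toReal ∂ν) ^ (θ * ρ / r₂.toReal) := by
    refine le_trans ?_ (ENNReal.lintegral_mul_norm_pow_le (ha.pow_const _).aemeasurable
      (hb.pow_const _).aemeasurable (by positivity) (by positivity) ?_)
    · refine lintegral_mono fun x => ?_
      calc h x ^ ρ ≤ (a x ^ (1 - θ) * b x ^ θ) ^ ρ := by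
            gcongr
            exact hab x
        _ = _ := by
            rw [ENNReal.mul_rpow_of_nonneg _ _ hρ0.le]
            simp_rw [← ENNReal.rpow_mul]
            congr 2 <;> field_simp
    · calc _ = ρ * ((1 - θ) * (1 / r₁.toReal) + θ * (1 / r₂.toReal)) := by ring
        _ = 1 := by rw [← hinv]; field_simp
  calc _ ≤ _ := ENNReal.rpow_le_rpow key (by positivity : 0 ≤ 1 / ρ)
    _ = _ := by
      rw [ENNReal.mul_rpow_of_nonneg _ _ (by positivity)]
      simp_rw [← ENNReal.rpow_mul]
      congr 2 <;> field_simp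

/-- An `L^r₁` quasi-norm that controls the supremum controls every `L^r₂`, `r₁ ≤ r₂`. -/
theorem supNorm_le_of_le {r₁ r₂ : ℝ≥0∞} (hr₁ : 1 ≤ r₁) (hr : r₁ ≤ r₂) (hm : Measurable h)
    {K : ℝ≥0∞} (hK : 1 ≤ K) (hsup : ∀ x, h x ≤ K * supNorm ν r₁ h) :
    supNorm ν r₂ h ≤ K * supNorm ν r₁ h := by
  rcases hr.eq_or_lt with rfl | hlt
  · exact le_mul_of_one_le_left' hK
  by_cases h2 : r₂ = ∞
  · subst h2
    rw [supNorm_top]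
    exact iSup_le hsup
  have h1 : r₁ ≠ ∞ := hlt.ne_top
  have hp₁ : 0 < r₁.toReal := by linarith [toReal_ge_one hr₁ h1]
  have hp : r₁.toReal < r₂.toReal := (ENNReal.toReal_lt_toReal h1 h2).2 hlt
  have hp₂ : 0 < r₂.toReal := hp₁.trans hp
  have h0 : 0 < r₁.toReal / r₂.toReal := by positivity
  have h1' : r₁.toReal / r₂.toReal < 1 := (div_lt_one hp₂).2 hp
  -- `r₂` is the exponent between `∞` and `r₁` at parameter `r₁/r₂`, so Hölder with `a = b = h`
  -- bounds the `L^{r₂}` norm by the supremum and the `L^{r₁}` norm.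
  have e : interpExp (r₁.toReal / r₂.toReal) ∞ r₁ = r₂ := by
    rw [interpExp_top_left _ h0, ENNReal.ofReal_div_of_pos hp₂, ENNReal.ofReal_toReal h1,
      ENNReal.ofReal_toReal h2, ENNReal.div_eq_inv_mul, ENNReal.inv_div (by simp [h2]) (Or.inr
        (by positivity)), ENNReal.div_mul_cancel (by positivity) h1]
  have := supNorm_interp_top_left (ν := ν) (h := h) (a := h) (b := h) h0 h1' hr₁ h1 hm (fun x => by
    rw [← ENNReal.rpow_add_of_nonneg _ _ (by linarith) h0.le]; simp)
  rw [e] at this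
  refine this.trans ?_
  set τ := r₁.toReal / r₂.toReal
  rw [supNorm_top]
  calc _ ≤ (K * supNorm ν r₁ h) ^ (1 - τ) * (K * supNorm ν r₁ h) ^ τ := by
        gcongr
        · exact iSup_le hsup
        · exact le_mul_of_one_le_left' hK
    _ = _ := by
        rw [← ENNReal.rpow_add_of_nonneg _ _ (by linarith) h0.le]; simp

end supNorm

/-! ### Sequence norms and geometric sums. -/

theorem seqNorm_eq (r : ℝ≥0∞) (a : ℕ → ℝ≥0∞) : seqNorm r a = supNorm Measure.count r a := by
  simp [seqNorm, supNorm, lintegral_count]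

theorem le_seqNorm {r : ℝ≥0∞} (hr : 1 ≤ r) (a : ℕ → ℝ≥0∞) (j : ℕ) : a j ≤ seqNorm r a := by
  unfold seqNorm
  split_ifs with h
  · exact le_iSup a j
  · have hr0 : 0 < r.toReal := by linarith [toReal_ge_one hr h]
    calc a j = (a j ^ r.toReal) ^ (1 / r.toReal) := by
          rw [← ENNReal.rpow_mul, mul_one_div_cancel hr0.ne', ENNReal.rpow_one]
      _ ≤ _ := by
          gcongr
          exact ENNReal.le_tsum j

theorem seqNorm_mono (r : ℝ≥0∞) {a b : ℕ → ℝ≥0∞} (h : ∀ j, a j ≤ b j) :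
    seqNorm r a ≤ seqNorm r b := by
  simpa only [seqNorm_eq] using supNorm_mono r h

theorem seqNorm_const_mul {r : ℝ≥0∞} (hr : 1 ≤ r) {c : ℝ≥0∞} (hc : c ≠ ∞) (a : ℕ → ℝ≥0∞) :
    seqNorm r (fun j => c * a j) = c * seqNorm r a := by
  simpa only [seqNorm_eq] using supNorm_const_mul hr hc

theorem seqNorm_le_of_le {r₁ r₂ : ℝ≥0∞} (hr₁ : 1 ≤ r₁) (hr : r₁ ≤ r₂) (a : ℕ → ℝ≥0∞) :
    seqNorm r₂ a ≤ seqNorm r₁ a := by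
  have := supNorm_le_of_le (ν := Measure.count) (h := a) hr₁ hr measurable_from_nat le_rfl
    (fun j => by rw [one_mul, ← seqNorm_eq]; exact le_seqNorm hr₁ a j)
  simpa only [seqNorm_eq, one_mul] using this

theorem seqNorm_le_tsum {r : ℝ≥0∞} (hr : 1 ≤ r) (a : ℕ → ℝ≥0∞) : seqNorm r a ≤ ∑' j, a j :=
  (seqNorm_le_of_le le_rfl hr a).trans (by simp [seqNorm])

theorem seqNorm_interp {θ : ℝ} (h0 : 0 < θ) (h1 : θ < 1) {r₁ r₂ : ℝ≥0∞}
    (hr₁ : 1 ≤ r₁) (hr₂ : 1 ≤ r₂) {x a b : ℕ → ℝ≥0∞}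
    (hab : ∀ j, x j ≤ a j ^ (1 - θ) * b j ^ θ) :
    seqNorm (interpExp θ r₁ r₂) x ≤ seqNorm r₁ a ^ (1 - θ) * seqNorm r₂ b ^ θ := by
  simpa only [seqNorm_eq] using
    supNorm_interp h0 h1 hr₁ hr₂ measurable_from_nat measurable_from_nat hab

/-- Sums of `min(y_j, y_j⁻¹)` along a geometric progression `y_j = y₀ ρ^j` with `ρ < 1` are bounded
independently of `y₀`. -/
theorem tsum_min_inv_le {y₀ ρ : ℝ≥0∞} (hy : y₀ ≠ ∞) (hρ : ρ < 1) :
    ∑' j : ℕ, min (y₀ * ρ ^ j) (y₀ * ρ ^ j)⁻¹ ≤ 2 * (1 - ρ)⁻¹ := by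
  classical
  have hex : ∃ J : ℕ, y₀ * ρ ^ J ≤ 1 := by
    have ht : Filter.Tendsto (fun J : ℕ => y₀ * ρ ^ J) Filter.atTop (nhds (y₀ * 0)) :=
      ENNReal.Tendsto.const_mul (ENNReal.tendsto_pow_atTop_nhds_zero_of_lt_one hρ) (Or.inr hy)
    rw [mul_zero] at ht
    exact (ht.eventually_le_const one_pos).exists
  -- `J` is the first index with `y_J ≤ 1`. From `J` on, `y_j` decays geometrically from a value at
  -- most `1`; before `J`, `y_j⁻¹` is at most `ρ^(J-1-j)`. Each half is dominated by the full
  -- geometric series.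
  obtain ⟨J, hJ1, hmin⟩ : ∃ J : ℕ, y₀ * ρ ^ J ≤ 1 ∧ ∀ m < J, 1 < y₀ * ρ ^ m :=
    ⟨Nat.find hex, Nat.find_spec hex, fun m hm => not_le.1 (Nat.find_min hex hm)⟩
  have hs : Summable fun j => min (y₀ * ρ ^ (j + J)) (y₀ * ρ ^ (j + J))⁻¹ := ENNReal.summable
  rw [← Summable.sum_add_tsum_nat_add' (f := fun j => min (y₀ * ρ ^ j) (y₀ * ρ ^ j)⁻¹) hs, two_mul]
  refine add_le_add ?_ ?_
  · calc _ ≤ ∑ j ∈ Finset.range J, ρ ^ (J - 1 - j) := by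
          refine Finset.sum_le_sum fun j hj => (min_le_right _ _).trans ?_
          have hj' : j < J := Finset.mem_range.1 hj
          have h1 : 1 < y₀ * ρ ^ (J - 1) := hmin _ (by omega)
          rw [ENNReal.inv_le_iff_le_mul (fun h => absurd h (ENNReal.pow_ne_top hρ.ne_top))
            (fun h => absurd h (ENNReal.mul_ne_top hy (ENNReal.pow_ne_top hρ.ne_top)))]
          calc (1 : ℝ≥0∞) ≤ y₀ * ρ ^ (J - 1) := h1.le
            _ = _ := by
              rw [mul_assoc, ← pow_add]; congr 2; omega
      _ = ∑ j ∈ Finset.range J, ρ ^ j := Finset.sum_range_reflect (fun j => ρ ^ j) J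
      _ ≤ ∑' j, ρ ^ j := ENNReal.sum_le_tsum _
      _ = _ := ENNReal.tsum_geometric ρ
  · calc _ ≤ ∑' j : ℕ, ρ ^ j := by
          refine ENNReal.tsum_le_tsum fun j => (min_le_left _ _).trans ?_
          rw [add_comm, pow_add, ← mul_assoc]
          exact mul_le_of_le_one_left' hJ1
      _ = _ := ENNReal.tsum_geometric ρ

/-! ### Lorentz quasi-norms and weak-type bounds. -/

/-- The measure `dα/α` on `(0,∞)`. -/
def logMeasure : Measure ℝ :=
  (volume.restrict (Ioi (0 : ℝ))).withDensity fun α => (ENNReal.ofReal α)⁻¹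

theorem lintegral_logMeasure {f : ℝ → ℝ≥0∞} (hf : Measurable f) :
    ∫⁻ α, f α ∂logMeasure = ∫⁻ α in Ioi (0 : ℝ), f α / ENNReal.ofReal α := by
  rw [logMeasure, lintegral_withDensity_eq_lintegral_mul _ (by fun_prop) hf]
  simp [div_eq_mul_inv, mul_comm]

/-- The integrand `α μ_g(α)^t` of the Lorentz quasi-norms, `t = 1/p`. -/
def lorentzFn {n : ℕ} (t : ℝ) (g : Rn n → ℂ) (α : ℝ) : ℝ≥0∞ :=
  ENNReal.ofReal α * distribFun g α ^ t

/-- The weak-type bound `α μ_g(α)^t ≤ A`, where `t = 1/p`; for `t = 0` it says `‖g‖_∞ ≤ A`. -/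
def WeakBound {n : ℕ} (t : ℝ) (g : Rn n → ℂ) (A : ℝ≥0∞) : Prop :=
  ∀ α : ℝ, 0 < α → distribFun g α ≠ 0 → lorentzFn t g α ≤ A

section Lorentz

variable {n : ℕ} {g : Rn n → ℂ}

theorem distribFun_antitone (g : Rn n → ℂ) : Antitone (distribFun g) := fun _ _ h =>
  measure_mono fun _ hx => lt_of_le_of_lt h hx

theorem measurable_lorentzFn (t : ℝ) (g : Rn n → ℂ) : Measurable (lorentzFn t g) :=
  ENNReal.measurable_ofReal.mul ((distribFun_antitone g).measurable.pow_const t)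

theorem lorentzNorm_of_ne_top {p : ℝ≥0∞} (hp : p ≠ ∞) {q : ℝ≥0∞} (hq : 1 ≤ q) (g : Rn n → ℂ) :
    lorentzNorm p q g =
      p ^ (q⁻¹).toReal * supNorm logMeasure q (lorentzFn (p⁻¹).toReal g) := by
  by_cases hq' : q = ∞
  · subst hq'
    simp only [lorentzNorm, hp, if_false, if_true, ENNReal.inv_top, ENNReal.toReal_zero,
      ENNReal.rpow_zero, one_mul, supNorm_top, toReal_inv_eq_one_div]
    refine le_antisymm (iSup₂_le fun α _ => le_iSup (lorentzFn _ g) α) (iSup_le fun α => ?_)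
    by_cases hα : 0 < α
    · exact le_iSup₂ (f := fun α (_ : 0 < α) => ENNReal.ofReal α * distribFun g α ^ (1 / p.toReal))
        α hα
    · simp [lorentzFn, ENNReal.ofReal_of_nonpos (not_lt.1 hα)]
  · have hq0 : 0 < q.toReal := by linarith [toReal_ge_one hq hq']
    rw [supNorm_of_ne_top hq', lintegral_logMeasure ((measurable_lorentzFn _ g).pow_const _)]
    simp only [lorentzNorm, hp, hq', if_false, toReal_inv_eq_one_div, lorentzFn]
    rw [ENNReal.mul_rpow_of_nonneg _ _ (by positivity)]

/-- Since `μ_g` is antitone, `lorentzFn` on `(α/2, α]` is at least half its value at `α`, and this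
interval has `dα/α`-mass at least `1/2`. Hence the constant `2 · 2^{1/q} ≤ 4`, by `q ≥ 1`. -/
theorem lorentzFn_le_supNorm {q : ℝ≥0∞} (hq : 1 ≤ q) {t : ℝ} (ht : 0 ≤ t) (g : Rn n → ℂ) (α : ℝ) :
    lorentzFn t g α ≤ 4 * supNorm logMeasure q (lorentzFn t g) := by
  by_cases hq' : q = ∞
  · subst hq'
    rw [supNorm_top]
    exact (le_iSup (lorentzFn t g) α).trans (le_mul_of_one_le_left' (by norm_num))
  have hq1 := toReal_ge_one hq hq'
  rw [supNorm_of_ne_top hq', lintegral_logMeasure ((measurable_lorentzFn _ g).pow_const _)]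
  rcases le_or_gt α 0 with hα | hα
  · simp [lorentzFn, ENNReal.ofReal_of_nonpos hα]
  set Q := q.toReal
  set h := lorentzFn t g α with hh
  have key : (h / 4) ^ Q ≤ ∫⁻ β in Ioi (0 : ℝ), lorentzFn t g β ^ Q / ENNReal.ofReal β := by
    calc (h / 4) ^ Q ≤ (h / 2) ^ Q / 2 := by
          have : h / 4 = (h / 2) / 2 := by
            rw [ENNReal.div_eq_inv_mul, ENNReal.div_eq_inv_mul, ENNReal.div_eq_inv_mul, ← mul_assoc,
              ← ENNReal.mul_inv (by simp) (by simp)]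
            norm_num
          rw [this, ENNReal.div_rpow_of_nonneg _ _ (by linarith)]
          gcongr
          calc (2 : ℝ≥0∞) = 2 ^ (1 : ℝ) := by simp
            _ ≤ _ := ENNReal.rpow_le_rpow_of_exponent_le (by norm_num) hq1
      _ = ∫⁻ β in Ioc (α / 2) α, (h / 2) ^ Q / ENNReal.ofReal α := by
          rw [lintegral_const, Measure.restrict_apply MeasurableSet.univ, univ_inter,
            Real.volume_Ioc, show α - α / 2 = α / 2 by ring, ENNReal.ofReal_div_of_pos (by norm_num),
            ENNReal.div_eq_inv_mul, ENNReal.div_eq_inv_mul, ENNReal.div_eq_inv_mul, ENNReal.ofReal_ofNat]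
          have h1 : ENNReal.ofReal α ≠ 0 := by simpa
          calc _ = 2⁻¹ * (h / 2) ^ Q * ((ENNReal.ofReal α)⁻¹ * ENNReal.ofReal α) := by
                rw [ENNReal.inv_mul_cancel h1 ENNReal.ofReal_ne_top, mul_one,
                  ENNReal.div_eq_inv_mul]
            _ = _ := by simp only [ENNReal.div_eq_inv_mul]; ring
      _ ≤ ∫⁻ β in Ioc (α / 2) α, lorentzFn t g β ^ Q / ENNReal.ofReal β := by
          refine setLIntegral_mono' measurableSet_Ioc fun β hβ => ?_
          have hβα : ENNReal.ofReal β ≤ ENNReal.ofReal α := ENNReal.ofReal_le_ofReal hβ.2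
          have : h / 2 ≤ lorentzFn t g β := by
            rw [hh, lorentzFn, lorentzFn, ENNReal.div_eq_inv_mul, ← mul_assoc]
            refine mul_le_mul' ?_ (ENNReal.rpow_le_rpow (distribFun_antitone g hβ.2) ht)
            rw [← ENNReal.div_eq_inv_mul, ← ENNReal.ofReal_ofNat 2,
              ← ENNReal.ofReal_div_of_pos (by norm_num)]
            exact ENNReal.ofReal_le_ofReal hβ.1.le
          gcongr
      _ ≤ _ := lintegral_mono_set fun β hβ => (by have := hβ.1; simp; linarith)
  have h4 : h / 4 ≤ (∫⁻ β in Ioi (0 : ℝ), lorentzFn t g β ^ Q / ENNReal.ofReal β) ^ (1 / Q) := by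
    calc h / 4 = ((h / 4) ^ Q) ^ (1 / Q) := by
          rw [← ENNReal.rpow_mul, mul_one_div_cancel (by linarith), ENNReal.rpow_one]
      _ ≤ _ := ENNReal.rpow_le_rpow key (by positivity)
  rw [mul_comm]
  exact (ENNReal.div_le_iff (by norm_num) (by norm_num)).1 h4

/-- The clause `distribFun g α ≠ 0` in `WeakBound` matters here: since `0 ^ 0 = 1`, without it the
bound at `t = 0` would force `α ≤ A` for all `α`. -/
theorem weakBound_zero_lorentzNorm (g : Rn n → ℂ) : WeakBound 0 g (lorentzNorm ∞ ∞ g) := by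
  intro α _ hne
  simp only [lorentzFn, lorentzNorm, if_true, ENNReal.rpow_zero, mul_one]
  refine le_iInf₂ fun β hβ => ENNReal.ofReal_le_ofReal ?_
  by_contra hlt
  exact hne (le_antisymm ((distribFun_antitone g (not_le.1 hlt).le).trans hβ.2.le) zero_le)

theorem lorentzNorm_top_le {A : ℝ≥0∞} (h : WeakBound 0 g A) :
    lorentzNorm ∞ ∞ g ≤ A := by
  simp only [lorentzNorm, if_true]
  refine le_of_forall_gt fun b hb => ?_
  obtain ⟨c, hc, hcb⟩ := exists_between hb
  have hct : c ≠ ∞ := hcb.ne_top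
  have hc0 : 0 < c.toReal := ENNReal.toReal_pos (ne_bot_of_gt hc) hct
  refine (iInf₂_le c.toReal ⟨hc0, ?_⟩).trans_lt ((ENNReal.ofReal_toReal hct).le.trans_lt hcb)
  by_contra hne
  have := h _ hc0 hne
  simp only [lorentzFn, ENNReal.rpow_zero, mul_one, ENNReal.ofReal_toReal hct] at this
  exact absurd this (not_le.2 hc)

/-- This embedding into weak `L^p` is all that the Nikolskii and real interpolation arguments use of
the two given norms. -/
theorem weakBound_lorentzNorm {p q : ℝ≥0∞} (hp : 1 ≤ p) (hq : 1 ≤ q) (hpq : p = ∞ → q = ∞)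
    (g : Rn n → ℂ) : WeakBound (p⁻¹).toReal g (4 * lorentzNorm p q g) := by
  by_cases hp' : p = ∞
  · obtain rfl := hpq hp'
    subst hp'
    intro α h0 h1
    simpa using (weakBound_zero_lorentzNorm g α h0 h1).trans
      (le_mul_of_one_le_left' (by norm_num : (1 : ℝ≥0∞) ≤ 4))
  · intro α _ _
    refine (lorentzFn_le_supNorm hq ENNReal.toReal_nonneg g α).trans ?_
    rw [lorentzNorm_of_ne_top hp' hq]
    gcongr
    refine le_mul_of_one_le_left' ?_
    simpa using ENNReal.rpow_le_rpow hp (ENNReal.toReal_nonneg (a := q⁻¹))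

theorem lorentzNorm_le_of_le {p q₁ q₂ : ℝ≥0∞} (hp : 1 ≤ p) (hq₁ : 1 ≤ q₁) (hq : q₁ ≤ q₂)
    (hpq : p = ∞ → q₁ = ∞) (g : Rn n → ℂ) : lorentzNorm p q₂ g ≤ 4 * lorentzNorm p q₁ g := by
  by_cases hp' : p = ∞
  · obtain rfl := hpq hp'
    obtain rfl := top_le_iff.1 hq
    exact le_mul_of_one_le_left' (by norm_num)
  · rw [lorentzNorm_of_ne_top hp' hq₁, lorentzNorm_of_ne_top hp' (hq₁.trans hq), mul_left_comm]
    refine mul_le_mul' (ENNReal.rpow_le_rpow_of_exponent_le hp ?_) ?_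
    · refine ENNReal.toReal_mono (by simp; positivity) (by simpa)
    · exact supNorm_le_of_le hq₁ hq (measurable_lorentzFn _ g) (by norm_num)
        (lorentzFn_le_supNorm hq₁ ENNReal.toReal_nonneg g)

/-- With `p` fixed, all three norms are `L^q(dα/α)` norms of the same function, so Hölder applies
with `a = b = h`. The prefactors `p^{1/q}` match exactly because `1/q_*` is the convex combination
of `1/q₁` and `1/q₂`. -/
theorem lorentzNorm_interp {θ : ℝ} (h0 : 0 < θ) (h1 : θ < 1) {p q₁ q₂ : ℝ≥0∞}
    (hq₁ : 1 ≤ q₁) (hq₂ : 1 ≤ q₂) (hpq₁ : p = ∞ → q₁ = ∞) (hpq₂ : p = ∞ → q₂ = ∞) (g : Rn n → ℂ) :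
    lorentzNorm p (interpExp θ q₁ q₂) g ≤
      lorentzNorm p q₁ g ^ (1 - θ) * lorentzNorm p q₂ g ^ θ := by
  by_cases hp' : p = ∞
  · obtain rfl := hpq₁ hp'
    obtain rfl := hpq₂ hp'
    rw [(interpExp_eq_top h0 h1).2 ⟨rfl, rfl⟩, ← ENNReal.rpow_add_of_nonneg _ _ (by linarith) h0.le]
    simp
  · have hq := one_le_interpExp h0.le h1.le hq₁ hq₂
    have hθ : 0 ≤ 1 - θ := by linarith
    rw [lorentzNorm_of_ne_top hp' hq₁, lorentzNorm_of_ne_top hp' hq₂, lorentzNorm_of_ne_top hp' hq,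
      ENNReal.mul_rpow_of_nonneg _ _ hθ, ENNReal.mul_rpow_of_nonneg _ _ h0.le, mul_mul_mul_comm,
      interpExp_inv_toReal h0.le h1.le hq₁ hq₂, ← ENNReal.rpow_mul, ← ENNReal.rpow_mul,
      ← ENNReal.rpow_add_of_nonneg _ _ (by positivity) (by positivity), mul_comm (1 - θ),
      mul_comm θ]
    gcongr
    refine supNorm_interp h0 h1 hq₁ hq₂ (measurable_lorentzFn _ g) (measurable_lorentzFn _ g)
      fun α => ?_
    rw [← ENNReal.rpow_add_of_nonneg _ _ (by linarith) h0.le]; simp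

/-- For each `α` the function `lorentzFn` at the intermediate `t` is the geometric mean of those at
`t₁` and `t₂`. -/
theorem WeakBound.interp {t₁ t₂ φ : ℝ} {A₁ A₂ : ℝ≥0∞} (ht₁ : 0 ≤ t₁) (ht₂ : 0 ≤ t₂) (h0 : 0 ≤ φ)
    (h1 : φ ≤ 1) (hA₁ : WeakBound t₁ g A₁) (hA₂ : WeakBound t₂ g A₂) :
    WeakBound ((1 - φ) * t₁ + φ * t₂) g (A₁ ^ (1 - φ) * A₂ ^ φ) := by
  intro α hα hne
  have hφ : 0 ≤ 1 - φ := by linarith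
  calc lorentzFn ((1 - φ) * t₁ + φ * t₂) g α = lorentzFn t₁ g α ^ (1 - φ) * lorentzFn t₂ g α ^ φ := by
        simp only [lorentzFn]
        rw [ENNReal.mul_rpow_of_nonneg _ _ hφ, ENNReal.mul_rpow_of_nonneg _ _ h0, mul_mul_mul_comm,
          ← ENNReal.rpow_mul, ← ENNReal.rpow_mul, mul_comm (1 - φ) t₁, mul_comm φ t₂,
          ENNReal.rpow_add_of_nonneg _ _ (by positivity) (by positivity),
          ← ENNReal.rpow_add_of_nonneg _ _ hφ h0]
        simp
    _ ≤ _ := by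
      gcongr
      · exact hA₁ α hα hne
      · exact hA₂ α hα hne

end Lorentz

/-! ### Real interpolation between two weak-type bounds. -/

theorem lintegral_Ioc_rpow {a c : ℝ} (ha : 0 < a) (hc : 0 < c) :
    ∫⁻ α in Ioc (0 : ℝ) c, ENNReal.ofReal (α ^ (a - 1)) = ENNReal.ofReal (c ^ a / a) := by
  rw [← ofReal_integral_eq_lintegral_ofReal]
  · rw [← intervalIntegral.integral_of_le hc.le, integral_rpow (Or.inl (by linarith))]
    simp [Real.zero_rpow ha.ne']
  · rw [← IntegrableOn, ← intervalIntegrable_iff_integrableOn_Ioc_of_le hc.le]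
    exact intervalIntegral.intervalIntegrable_rpow' (by linarith)
  · filter_upwards [ae_restrict_mem measurableSet_Ioc] with x hx
    exact Real.rpow_nonneg hx.1.le _

theorem lintegral_Ioi_rpow {b c : ℝ} (hb : 0 < b) (hc : 0 < c) :
    ∫⁻ α in Ioi c, ENNReal.ofReal (α ^ (-b - 1)) = ENNReal.ofReal (c ^ (-b) / b) := by
  rw [← ofReal_integral_eq_lintegral_ofReal]
  · rw [integral_Ioi_rpow_of_lt (by linarith) hc]
    congr 1
    rw [show -b - 1 + 1 = -b by ring, neg_div_neg_eq]
  · exact integrableOn_Ioi_rpow_of_lt (by linarith) hc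
  · filter_upwards [ae_restrict_mem measurableSet_Ioi] with x hx
    exact Real.rpow_nonneg (hc.trans hx).le _

/-- Split at the point `c` where the two majorants `x α^(a-1)` and `y α^(-b-1)` cross; there `x c^a
= y c^(-b)`, so both pieces produce the same product of powers. -/
theorem lintegral_min_rpow_le {a b x y : ℝ} (ha : 0 < a) (hb : 0 < b) (hx : 0 < x) (hy : 0 < y)
    {F : ℝ → ℝ≥0∞} (h₁ : ∀ α, 0 < α → F α ≤ ENNReal.ofReal (x * α ^ (a - 1)))
    (h₂ : ∀ α, 0 < α → F α ≤ ENNReal.ofReal (y * α ^ (-b - 1))) :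
    ∫⁻ α in Ioi (0 : ℝ), F α ≤
      ENNReal.ofReal (1 / a + 1 / b) * ENNReal.ofReal (x ^ (b / (a + b)) * y ^ (a / (a + b))) := by
  have hab : 0 < a + b := by positivity
  set c := (y / x) ^ (1 / (a + b)) with hc
  have hc0 : 0 < c := by positivity
  have e1 : x * c ^ a = x ^ (b / (a + b)) * y ^ (a / (a + b)) := by
    rw [hc, ← Real.rpow_mul (by positivity), Real.div_rpow hy.le hx.le, mul_div_assoc', mul_comm x,
      mul_div_assoc, mul_comm]
    congr 1
    · rw [div_eq_iff (by positivity), ← Real.rpow_add hx]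
      conv_lhs => rw [← Real.rpow_one x]
      congr 1; field_simp; ring
    · congr 1; ring
  have e2 : y * c ^ (-b) = x ^ (b / (a + b)) * y ^ (a / (a + b)) := by
    rw [hc, ← Real.rpow_mul (by positivity), ← inv_div, Real.inv_rpow (by positivity),
      ← Real.rpow_neg (by positivity), Real.div_rpow hx.le hy.le, mul_div_assoc', mul_comm y,
      mul_div_assoc]
    congr 1
    · congr 1; ring
    · rw [div_eq_iff (by positivity), ← Real.rpow_add hy]
      conv_lhs => rw [← Real.rpow_one y]
      congr 1; field_simp
  rw [← Ioc_union_Ioi_eq_Ioi hc0.le, lintegral_union measurableSet_Ioi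
    (by rw [disjoint_left]; intro z hz hz'; exact absurd hz.2 (not_le.2 hz'))]
  calc _ ≤ (∫⁻ α in Ioc 0 c, ENNReal.ofReal x * ENNReal.ofReal (α ^ (a - 1))) +
        ∫⁻ α in Ioi c, ENNReal.ofReal y * ENNReal.ofReal (α ^ (-b - 1)) := by
        gcongr 1
        · refine setLIntegral_mono' measurableSet_Ioc fun α hα => ?_
          rw [← ENNReal.ofReal_mul hx.le]; exact h₁ α hα.1
        · refine setLIntegral_mono' measurableSet_Ioi fun α hα => ?_
          rw [← ENNReal.ofReal_mul hy.le]; exact h₂ α (hc0.trans hα)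
    _ = ENNReal.ofReal (x * c ^ a / a + y * c ^ (-b) / b) := by
        rw [lintegral_const_mul' _ _ (by simp), lintegral_const_mul' _ _ (by simp),
          lintegral_Ioc_rpow ha hc0, lintegral_Ioi_rpow hb hc0, ← ENNReal.ofReal_mul hx.le,
          ← ENNReal.ofReal_mul hy.le, ← ENNReal.ofReal_add (by positivity) (by positivity)]
        congr 1; ring
    _ = _ := by
        rw [e1, e2, ← ENNReal.ofReal_mul (by positivity)]
        congr 1; ring

section WeakInterpolation

variable {n : ℕ}

theorem WeakBound.distribFun_rpow_le {g : Rn n → ℂ} {t₁ t : ℝ} {A : ℝ≥0∞} (h : WeakBound t₁ g A)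
    (hA : A ≠ ∞) (ht₁ : 0 < t₁) (ht : 0 < t) {α : ℝ} (hα : 0 < α) :
    lorentzFn t g α / ENNReal.ofReal α ≤ ENNReal.ofReal (A.toReal ^ (t / t₁) * α ^ (-(t / t₁))) := by
  have hα' : ENNReal.ofReal α ≠ 0 := by simpa
  have e : lorentzFn t g α / ENNReal.ofReal α = distribFun g α ^ t := by
    rw [lorentzFn, mul_comm, ENNReal.mul_div_cancel_right hα' ENNReal.ofReal_ne_top]
  rw [e]
  by_cases h0 : distribFun g α = 0
  · rw [h0, ENNReal.zero_rpow_of_pos ht]; exact zero_le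
  have h1 := h α hα h0
  rw [lorentzFn, mul_comm, ← ENNReal.le_div_iff_mul_le (Or.inl hα') (Or.inl ENNReal.ofReal_ne_top)] at h1
  calc distribFun g α ^ t = (distribFun g α ^ t₁) ^ (t / t₁) := by
        rw [← ENNReal.rpow_mul]; congr 1; field_simp
    _ ≤ (A / ENNReal.ofReal α) ^ (t / t₁) := by gcongr
    _ = _ := by
      rw [← ENNReal.ofReal_toReal hA, ← ENNReal.ofReal_div_of_pos hα, ENNReal.ofReal_rpow_of_nonneg
        (by positivity) (by positivity), Real.div_rpow (by positivity) hα.le,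
        Real.rpow_neg hα.le, div_eq_mul_inv, ENNReal.toReal_ofReal (by positivity)]

theorem WeakBound.lorentzFn_eq_zero {g : Rn n → ℂ} {t₁ t : ℝ} (h : WeakBound t₁ g 0)
    (ht₁ : 0 ≤ t₁) (ht : 0 < t) : lorentzFn t g = 0 := by
  funext α
  rcases le_or_gt α 0 with hα | hα
  · simp [lorentzFn, ENNReal.ofReal_of_nonpos hα]
  by_cases h0 : distribFun g α = 0
  · simp [lorentzFn, h0, ht]
  · have := h α hα h0
    simp only [lorentzFn, nonpos_iff_eq_zero, mul_eq_zero, ENNReal.ofReal_eq_zero,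
      ENNReal.rpow_eq_zero_iff, h0, false_and, false_or] at this
    rcases this with h | h
    · linarith
    · linarith [h.2]

theorem supNorm_zero {X : Type*} [MeasurableSpace X] {ν : Measure X} {r : ℝ≥0∞} (hr : 1 ≤ r) :
    supNorm ν r (0 : X → ℝ≥0∞) = 0 := by
  have := supNorm_const_mul (ν := ν) (h := 0) hr (c := 0) (by simp)
  simpa [Pi.zero_def] using this

/-- The integrand for `q = 1` is `μ_g(α)^t`, bounded by multiples of `α^(-t/t₁)` and `α^(-t/t₂)`. As
`t/t₁ < 1 < t/t₂`, the first is integrable at `0` and the second at infinity. -/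
theorem supNorm_one_lorentzFn_le_of_lt {t₁ t₂ θ : ℝ} (h₂ : 0 < t₂) (h₁₂ : t₂ < t₁) (h0 : 0 < θ)
    (h1 : θ < 1) : ∃ C : ℝ≥0∞, C ≠ ∞ ∧ ∀ (g : Rn n → ℂ) (A₁ A₂ : ℝ≥0∞), A₁ ≠ ∞ → A₂ ≠ ∞ →
      WeakBound t₁ g A₁ → WeakBound t₂ g A₂ →
      supNorm logMeasure 1 (lorentzFn ((1 - θ) * t₁ + θ * t₂) g) ≤
        C * (A₁ ^ (1 - θ) * A₂ ^ θ) := by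
  set t := (1 - θ) * t₁ + θ * t₂ with htdef
  have ht₁ : 0 < t₁ := h₂.trans h₁₂
  have hθ : 0 < 1 - θ := by linarith
  have ht : 0 < t := by positivity
  have htt₁ : t₁ - t = θ * (t₁ - t₂) := by rw [htdef]; ring
  have htt₂ : t - t₂ = (1 - θ) * (t₁ - t₂) := by rw [htdef]; ring
  have hd : 0 < t₁ - t₂ := by linarith
  set a := 1 - t / t₁ with ha
  set b := t / t₂ - 1 with hb
  have ea : a = θ * (t₁ - t₂) / t₁ := by rw [ha, ← htt₁]; field_simp
  have eb : b = (1 - θ) * (t₁ - t₂) / t₂ := by rw [hb, ← htt₂]; field_simp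
  have ha0 : 0 < a := by rw [ea]; positivity
  have hb0 : 0 < b := by rw [eb]; positivity
  have eab : a + b = t * (t₁ - t₂) / (t₁ * t₂) := by
    rw [ha, hb]; field_simp; ring
  refine ⟨ENNReal.ofReal (1 / a + 1 / b), ENNReal.ofReal_ne_top, fun g A₁ A₂ hA₁ hA₂ w₁ w₂ => ?_⟩
  by_cases z₁ : A₁ = 0
  · subst z₁
    rw [w₁.lorentzFn_eq_zero ht₁.le ht, supNorm_zero le_rfl]; exact zero_le
  by_cases z₂ : A₂ = 0
  · subst z₂
    rw [w₂.lorentzFn_eq_zero h₂.le ht, supNorm_zero le_rfl]; exact zero_le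
  have p₁ : 0 < A₁.toReal := ENNReal.toReal_pos z₁ hA₁
  have p₂ : 0 < A₂.toReal := ENNReal.toReal_pos z₂ hA₂
  rw [supNorm_of_ne_top (by simp)]
  simp only [ENNReal.toReal_one, ENNReal.rpow_one, div_one]
  rw [lintegral_logMeasure (measurable_lorentzFn _ g)]
  refine (lintegral_min_rpow_le (x := A₁.toReal ^ (t / t₁)) (y := A₂.toReal ^ (t / t₂)) ha0 hb0
    (by positivity) (by positivity)
    (fun α hα => (w₁.distribFun_rpow_le hA₁ ht₁ ht hα).trans_eq (by rw [ha]; ring_nf))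
    (fun α hα => (w₂.distribFun_rpow_le hA₂ h₂ ht hα).trans_eq (by rw [hb]; ring_nf))).trans_eq ?_
  congr 1
  rw [← Real.rpow_mul p₁.le, ← Real.rpow_mul p₂.le, ENNReal.ofReal_mul (by positivity),
    ← ENNReal.ofReal_rpow_of_pos p₁, ← ENNReal.ofReal_rpow_of_pos p₂, ENNReal.ofReal_toReal hA₁,
    ENNReal.ofReal_toReal hA₂]
  congr 2
  · rw [eab, eb]; field_simp
  · rw [eab, ea]; field_simp

theorem supNorm_one_lorentzFn_le {t₁ t₂ θ : ℝ} (ht₁ : 0 ≤ t₁) (ht₂ : 0 ≤ t₂) (hne : t₁ ≠ t₂)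
    (h0 : 0 < θ) (h1 : θ < 1) : ∃ C : ℝ≥0∞, C ≠ ∞ ∧ ∀ (g : Rn n → ℂ) (A₁ A₂ : ℝ≥0∞),
      A₁ ≠ ∞ → A₂ ≠ ∞ → WeakBound t₁ g A₁ → WeakBound t₂ g A₂ →
      supNorm logMeasure 1 (lorentzFn ((1 - θ) * t₁ + θ * t₂) g) ≤
        C * (A₁ ^ (1 - θ) * A₂ ^ θ) := by
  wlog h : t₂ < t₁ generalizing t₁ t₂ θ
  · obtain ⟨C, hC, H⟩ := this ht₂ ht₁ hne.symm (by linarith : 0 < 1 - θ) (by linarith)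
      (lt_of_le_of_ne (not_lt.1 h) hne)
    refine ⟨C, hC, fun g A₁ A₂ hA₁ hA₂ w₁ w₂ => ?_⟩
    have := H g A₂ A₁ hA₂ hA₁ w₂ w₁
    rwa [sub_sub_cancel, add_comm, mul_comm (A₂ ^ θ)] at this
  rcases ht₂.eq_or_lt with rfl | h₂
  -- At `t₂ = 0` the exponent `t/t₂` makes no sense. The endpoint is replaced by the weak bound at
  -- an intermediate parameter `φ` with `θ < φ < 1`; interpolating again at `θ/φ` returns to `θ`.
  · set φ := (1 + θ) / 2 with hφ
    have hφ0 : 0 < φ := by positivity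
    have hφ1 : φ < 1 := by rw [hφ]; linarith
    have hθφ : θ < φ := by rw [hφ]; linarith
    have hφ1' : 0 < 1 - φ := by linarith
    have p1 : 0 < (1 - φ) * t₁ + φ * 0 := by
      rw [mul_zero, add_zero]; exact mul_pos hφ1' h
    have p2 : (1 - φ) * t₁ + φ * 0 < t₁ := by nlinarith
    obtain ⟨C, hC, H⟩ := supNorm_one_lorentzFn_le_of_lt (n := n) p1 p2 (div_pos h0 hφ0)
      ((div_lt_one hφ0).2 hθφ)
    refine ⟨C, hC, fun g A₁ A₂ hA₁ hA₂ w₁ w₂ => ?_⟩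
    have := H g A₁ (A₁ ^ (1 - φ) * A₂ ^ φ) hA₁ (ENNReal.mul_ne_top
      (ENNReal.rpow_ne_top_of_nonneg hφ1'.le hA₁) (ENNReal.rpow_ne_top_of_nonneg hφ0.le hA₂)) w₁
      (w₁.interp ht₁ le_rfl hφ0.le hφ1.le w₂)
    have hτ : 0 ≤ 1 - θ / φ := sub_nonneg.2 ((div_le_one hφ0).2 hθφ.le)
    have hτ' : 0 ≤ (1 - φ) * (θ / φ) := by positivity
    rw [show (1 - θ / φ) * t₁ + θ / φ * ((1 - φ) * t₁ + φ * 0) = (1 - θ) * t₁ + θ * 0 by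
      field_simp; ring, ENNReal.mul_rpow_of_nonneg _ _ (by positivity), ← mul_assoc (A₁ ^ _),
      ← ENNReal.rpow_mul, ← ENNReal.rpow_mul, ← ENNReal.rpow_add_of_nonneg _ _ hτ hτ',
      show 1 - θ / φ + (1 - φ) * (θ / φ) = 1 - θ by field_simp; ring,
      show φ * (θ / φ) = θ by field_simp] at this
    exact this
  · exact supNorm_one_lorentzFn_le_of_lt h₂ h h0 h1

/-- Interpolation between two different weak-type bounds gives every Lorentz quasi-norm with the
intermediate integrability exponent. -/
theorem lorentzNorm_le_of_weakBound {t₁ t₂ θ : ℝ} (ht₁ : 0 ≤ t₁) (ht₂ : 0 ≤ t₂) (hne : t₁ ≠ t₂)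
    (h0 : 0 < θ) (h1 : θ < 1) {p q : ℝ≥0∞} (hp : p ≠ ∞) (hq : 1 ≤ q)
    (hpt : (p⁻¹).toReal = (1 - θ) * t₁ + θ * t₂) :
    ∃ C : ℝ≥0∞, C ≠ ∞ ∧ ∀ (g : Rn n → ℂ) (A₁ A₂ : ℝ≥0∞),
      A₁ ≠ ∞ → A₂ ≠ ∞ → WeakBound t₁ g A₁ → WeakBound t₂ g A₂ →
      lorentzNorm p q g ≤ C * (A₁ ^ (1 - θ) * A₂ ^ θ) := by
  obtain ⟨C, hC, H⟩ := supNorm_one_lorentzFn_le (n := n) ht₁ ht₂ hne h0 h1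
  refine ⟨p ^ (q⁻¹).toReal * (4 * C), ENNReal.mul_ne_top
    (ENNReal.rpow_ne_top_of_nonneg ENNReal.toReal_nonneg hp) (ENNReal.mul_ne_top (by simp) hC),
    fun g A₁ A₂ hA₁ hA₂ w₁ w₂ => ?_⟩
  rw [lorentzNorm_of_ne_top hp hq, mul_assoc, mul_assoc]
  gcongr
  refine (supNorm_le_of_le le_rfl hq (measurable_lorentzFn _ g) (by norm_num)
    (lorentzFn_le_supNorm le_rfl ENNReal.toReal_nonneg g)).trans ?_
  gcongr
  rw [hpt]
  exact H g A₁ A₂ hA₁ hA₂ w₁ w₂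

end WeakInterpolation

/-! ### From weak `L^p` to `L^∞` by a reproducing kernel. -/

section Nikolskii

variable {n : ℕ}

/-- A function dominated by its convolution with an integrable and bounded kernel is bounded by its
weak-type constant. -/
theorem le_of_le_convolution {G Ψ : Rn n → ℝ≥0∞} (hG : Measurable G)
    {t : ℝ} (ht : 0 < t) {C₁ C₂ A : ℝ≥0∞} (hC₁ : 1 ≤ C₁) (hC₁' : C₁ ≠ ∞) (hC₂ : C₂ ≠ ∞)
    (hint : ∫⁻ z, Ψ z ≤ C₁) (hsup : ∀ z, Ψ z ≤ C₂) {B : ℝ≥0∞} (hB : B ≠ ∞) (hGB : ∀ y, G y ≤ B)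
    (hconv : ∀ y, G y ≤ ∫⁻ z, G z * Ψ (y - z))
    (hweak : ∀ α : ℝ≥0∞, α ≠ 0 → α ≠ ∞ → volume {z | α < G z} ≠ 0 →
      α * volume {z | α < G z} ^ t ≤ A) (y : Rn n) :
    G y ≤ 2 * C₁ * (2 * C₂) ^ t * A := by
  set M := ⨆ y, G y with hM
  have hMB : M ≠ ∞ := ne_top_of_le_ne_top hB (iSup_le hGB)
  refine (le_iSup G y).trans ?_
  by_cases hM0 : M = 0
  · rw [← hM, hM0]; exact zero_le
  have h2C : 2 * C₁ ≠ 0 := by positivity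
  have h2C' : 2 * C₁ ≠ ∞ := ENNReal.mul_ne_top (by simp) hC₁'
  -- The level is chosen so that the part of the convolution over `{G ≤ α}` contributes at most `α
  -- C₁ = M/2`.
  set α := M / (2 * C₁) with hα
  have hα0 : α ≠ 0 := by simp [hα, hM0, h2C']
  have hα' : α ≠ ∞ := ENNReal.div_ne_top hMB h2C
  set E := {z | α < G z} with hE
  have hEm : MeasurableSet E := measurableSet_lt measurable_const hG
  have hαC : α * C₁ = M / 2 := by
    rw [hα, ENNReal.div_eq_inv_mul, ENNReal.div_eq_inv_mul, ENNReal.mul_inv (by simp) (by simp)]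
    calc _ = 2⁻¹ * M * (C₁⁻¹ * C₁) := by ring
      _ = _ := by rw [ENNReal.inv_mul_cancel (by positivity) hC₁', mul_one]
  have hle : M ≤ M / 2 + M * (C₂ * volume E) := by
    refine iSup_le fun y => (hconv y).trans ?_
    rw [← lintegral_add_compl _ hEm, add_comm]
    gcongr
    · calc ∫⁻ z in Eᶜ, G z * Ψ (y - z) ≤ ∫⁻ z in Eᶜ, α * Ψ (y - z) :=
            setLIntegral_mono' hEm.compl fun z hz => by
              gcongr; exact not_lt.1 hz
        _ ≤ ∫⁻ z, α * Ψ (y - z) := setLIntegral_le_lintegral _ _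
        _ = α * ∫⁻ z, Ψ (y - z) := lintegral_const_mul' _ _ hα'
        _ = α * ∫⁻ z, Ψ z := by rw [lintegral_sub_left_eq_self]
        _ ≤ M / 2 := by rw [← hαC]; gcongr
    · calc ∫⁻ z in E, G z * Ψ (y - z) ≤ ∫⁻ z in E, M * C₂ :=
            setLIntegral_mono' hEm fun z _ => mul_le_mul' (le_iSup G z) (hsup _)
        _ = _ := by rw [setLIntegral_const, mul_assoc]
  have hC20 : C₂ ≠ 0 := by
    rintro rfl
    simp only [zero_mul, mul_zero, add_zero] at hle
    exact absurd hle (not_le.2 (ENNReal.half_lt_self hM0 hMB))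
  -- Absorbing `M/2`, which needs `M` finite, forces the level set to have measure at least `1/(2
  -- C₂)`; the weak-type bound at level `α` then bounds `M`.
  have hV : (2 * C₂)⁻¹ ≤ volume E := by
    by_contra hlt
    rw [not_le] at hlt
    have hCV : C₂ * volume E < 2⁻¹ := by
      calc C₂ * volume E < C₂ * (2 * C₂)⁻¹ := by
            rwa [ENNReal.mul_lt_mul_iff_right hC20 hC₂]
        _ = _ := by
          rw [ENNReal.mul_inv (by simp) (by simp), mul_left_comm, ENNReal.mul_inv_cancel hC20 hC₂,
            mul_one]
    have : M / 2 + M * (C₂ * volume E) < M := by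
      calc _ < M / 2 + M * 2⁻¹ := by
            refine ENNReal.add_lt_add_left (ENNReal.div_ne_top hMB (by simp)) ?_
            rwa [ENNReal.mul_lt_mul_iff_right hM0 hMB]
        _ = M := by rw [← div_eq_mul_inv, ENNReal.add_halves]
    exact absurd hle (not_le.2 this)
  have h2 : 2 * C₂ ≠ ∞ := ENNReal.mul_ne_top (by simp) hC₂
  have hV0 : volume E ≠ 0 := by
    intro h0
    rw [h0, nonpos_iff_eq_zero, ENNReal.inv_eq_zero] at hV
    exact h2 hV
  have hA := hweak α hα0 hα' hV0
  rw [← hM]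
  have hinv : 1 ≤ (2 * C₂) ^ t * volume E ^ t := by
    rw [← ENNReal.mul_rpow_of_nonneg _ _ ht.le]
    have : 1 ≤ 2 * C₂ * volume E := by
      exact (ENNReal.inv_le_iff_le_mul (fun _ => by positivity) (fun h => absurd h h2)).1 hV
    simpa using ENNReal.rpow_le_rpow this ht.le
  calc M = 2 * C₁ * α := by rw [hα, ENNReal.mul_div_cancel h2C h2C']
    _ ≤ 2 * C₁ * α * ((2 * C₂) ^ t * volume E ^ t) := le_mul_of_one_le_right' hinv
    _ = 2 * C₁ * (2 * C₂) ^ t * (α * volume E ^ t) := by ring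
    _ ≤ _ := by gcongr

theorem WeakBound.volume_le {F : Rn n → ℂ} {t : ℝ} (ht : 0 ≤ t) {A : ℝ≥0∞} (h : WeakBound t F A)
    {G : Rn n → ℝ≥0∞} (hGF : ∀ z, G z ≤ ‖F z‖ₑ) (α : ℝ≥0∞) (hα : α ≠ 0) (hα' : α ≠ ∞)
    (hv : volume {z | α < G z} ≠ 0) : α * volume {z | α < G z} ^ t ≤ A := by
  have hsub : {z | α < G z} ⊆ {z : Rn n | α.toReal < ‖F z‖} := fun z hz => by
    have : α < ‖F z‖ₑ := lt_of_lt_of_le hz (hGF z)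
    rw [← ofReal_norm] at this
    exact (ENNReal.lt_ofReal_iff_toReal_lt hα').1 this
  have hm : volume {z | α < G z} ≤ distribFun F α.toReal := measure_mono hsub
  have := h α.toReal (ENNReal.toReal_pos hα hα') (fun h0 => hv (le_antisymm (hm.trans_eq h0) zero_le))
  rw [lorentzFn, ENNReal.ofReal_toReal hα'] at this
  exact (by gcongr : _ ≤ α * distribFun F α.toReal ^ t).trans this

/-- Schwartz functions are integrable against polynomial weights. -/
theorem integrable_one_add_pow_mul (Φ : 𝓢(Rn n, ℂ)) (N : ℕ) :
    Integrable fun u => (1 + ‖u‖) ^ N * ‖Φ u‖ := by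
  refine (((Φ.integrable (μ := volume)).norm.add (Φ.integrable_pow_mul volume N)).const_mul
    (2 ^ (N - 1))).mono' (by fun_prop) (.of_forall fun u => ?_)
  rw [Real.norm_of_nonneg (by positivity)]
  calc (1 + ‖u‖) ^ N * ‖Φ u‖ ≤ 2 ^ (N - 1) * (1 ^ N + ‖u‖ ^ N) * ‖Φ u‖ := by
        gcongr; exact add_pow_le zero_le_one (norm_nonneg u) N
    _ = _ := by simp; ring

/-- A function of at most polynomial growth that is reproduced by a Schwartz kernel is bounded by
its weak-type constant, with a factor depending on two norms of the kernel only. -/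
theorem enorm_le_of_reproducing {F : Rn n → ℂ} (hF : Continuous F) {Φ : 𝓢(Rn n, ℂ)}
    (hrep : ∀ y, F y = ∫ z, F z * Φ (y - z)) {K : ℝ} {N : ℕ} (hgr : ∀ y, ‖F y‖ ≤ K * (1 + ‖y‖) ^ N)
    {t : ℝ} (ht : 0 < t) {C₁ C₂ A : ℝ≥0∞} (hC₁ : 1 ≤ C₁) (hC₁' : C₁ ≠ ∞) (hC₂ : C₂ ≠ ∞)
    (hint : ∫⁻ z, ‖Φ z‖ₑ ≤ C₁) (hsup : ∀ z, ‖Φ z‖ₑ ≤ C₂) (hA : A ≠ ∞) (hw : WeakBound t F A)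
    (y : Rn n) : ‖F y‖ₑ ≤ 2 * C₁ * (2 * C₂) ^ t * A := by
  have hconv : ∀ y, ‖F y‖ₑ ≤ ∫⁻ z, ‖F z‖ₑ * ‖Φ (y - z)‖ₑ := fun y => by
    conv_lhs => rw [hrep y]
    refine (enorm_integral_le_lintegral_enorm _).trans_eq ?_
    simp [enorm_mul]
  -- First pass, for boundedness only: divide `F` by the weight `(1 + ‖x - z‖)^N` centred at `x`.
  -- The quotient is bounded by polynomial growth and equals `F x` at `z = x`, and the resulting
  -- constant does not depend on `x`.
  obtain ⟨B, hB, hFB⟩ : ∃ B : ℝ≥0∞, B ≠ ∞ ∧ ∀ y, ‖F y‖ₑ ≤ B := by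
    set Ψ : Rn n → ℝ≥0∞ := fun u => ENNReal.ofReal (1 + ‖u‖) ^ N * ‖Φ u‖ₑ with hΨ
    have eΨ : ∀ u, Ψ u = ENNReal.ofReal ((1 + ‖u‖) ^ N * ‖Φ u‖) := fun u => by
      rw [hΨ, ENNReal.ofReal_mul (by positivity), ENNReal.ofReal_pow (by positivity),
        ofReal_norm]
    have hdecay : ∃ D : ℝ, ∀ u, (1 + ‖u‖) ^ N * ‖Φ u‖ ≤ D := ⟨_, fun u => by
      simpa using SchwartzMap.one_add_le_sup_seminorm_apply (𝕜 := ℂ) (m := (N, 0)) (k := N) (n := 0)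
        le_rfl le_rfl Φ u⟩
    obtain ⟨D, hD⟩ := hdecay
    have hI : ∫⁻ u, Ψ u ≠ ∞ := by
      simp_rw [eΨ]
      exact (integrable_one_add_pow_mul Φ N).lintegral_lt_top.ne
    refine ⟨2 * (1 + ∫⁻ u, Ψ u) * (2 * ENNReal.ofReal D) ^ t * A, ?_, fun x => ?_⟩
    · refine ENNReal.mul_ne_top (ENNReal.mul_ne_top (ENNReal.mul_ne_top (by simp) (by simp [hI])) ?_) hA
      exact ENNReal.rpow_ne_top_of_nonneg ht.le (ENNReal.mul_ne_top (by simp) (by simp))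
    have hω : ∀ z : Rn n, ENNReal.ofReal (1 + ‖x - z‖) ^ N ≠ 0 := fun z => by
      refine pow_ne_zero _ ?_
      simp only [ne_eq, ENNReal.ofReal_eq_zero, not_le]; positivity
    have hω' : ∀ z : Rn n, ENNReal.ofReal (1 + ‖x - z‖) ^ N ≠ ∞ := fun z =>
      ENNReal.pow_ne_top ENNReal.ofReal_ne_top
    have := le_of_le_convolution (G := fun z => ‖F z‖ₑ / ENNReal.ofReal (1 + ‖x - z‖) ^ N) (Ψ := Ψ)
      (by fun_prop) ht (C₁ := 1 + ∫⁻ u, Ψ u) (C₂ := ENNReal.ofReal D) (A := A)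
      le_self_add (by simp [hI]) (by simp) le_add_self
      (fun u => by rw [eΨ]; exact ENNReal.ofReal_le_ofReal (hD u))
      (B := ENNReal.ofReal (K * (1 + ‖x‖) ^ N)) (by simp) (fun z => by
        refine ENNReal.div_le_of_le_mul ?_
        rw [← ENNReal.ofReal_pow (by positivity), ← ENNReal.ofReal_mul' (by positivity),
          ← ofReal_norm]
        refine ENNReal.ofReal_le_ofReal ((hgr z).trans ?_)
        have hK : 0 ≤ K := by
          have := (norm_nonneg _).trans (hgr 0)
          simpa using this
        rw [mul_assoc, ← mul_pow]
        gcongr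
        have : ‖z‖ ≤ ‖x‖ + ‖x - z‖ := by
          calc ‖z‖ = ‖x - (x - z)‖ := by simp
            _ ≤ _ := norm_sub_le _ _
        nlinarith [norm_nonneg x, norm_nonneg (x - z)])
      (fun y => by
        calc ‖F y‖ₑ / ENNReal.ofReal (1 + ‖x - y‖) ^ N
            ≤ (∫⁻ z, ‖F z‖ₑ * ‖Φ (y - z)‖ₑ) / ENNReal.ofReal (1 + ‖x - y‖) ^ N := by
              gcongr; exact hconv y
          _ = ∫⁻ z, (ENNReal.ofReal (1 + ‖x - y‖) ^ N)⁻¹ * (‖F z‖ₑ * ‖Φ (y - z)‖ₑ) := by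
              rw [ENNReal.div_eq_inv_mul, lintegral_const_mul' _ _ (ENNReal.inv_ne_top.2 (hω y))]
          _ ≤ _ := by
              refine lintegral_mono fun z => ?_
              -- Submultiplicativity of the weight moves it from `y` to `z`, at the cost of the
              -- factor `(1 + ‖y - z‖)^N`, which the Schwartz kernel absorbs into `Ψ`.
              have hsub : (ENNReal.ofReal (1 + ‖x - y‖) ^ N)⁻¹ ≤
                  (ENNReal.ofReal (1 + ‖x - z‖) ^ N)⁻¹ * ENNReal.ofReal (1 + ‖y - z‖) ^ N := by
                rw [← ENNReal.div_eq_inv_mul, ENNReal.le_div_iff_mul_le (Or.inl (hω z)) (Or.inl (hω' z)),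
                  ← ENNReal.div_eq_inv_mul]
                refine ENNReal.div_le_of_le_mul ?_
                rw [← mul_pow, ← ENNReal.ofReal_mul (by positivity)]
                gcongr
                have : ‖x - z‖ ≤ ‖x - y‖ + ‖y - z‖ := norm_sub_le_norm_sub_add_norm_sub x y z
                nlinarith [norm_nonneg (x - y), norm_nonneg (y - z)]
              calc _ ≤ ((ENNReal.ofReal (1 + ‖x - z‖) ^ N)⁻¹ * ENNReal.ofReal (1 + ‖y - z‖) ^ N) *
                    (‖F z‖ₑ * ‖Φ (y - z)‖ₑ) := by gcongr
                _ = _ := by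
                  simp only [hΨ, ENNReal.div_eq_inv_mul]; ring)
      (hw.volume_le ht.le fun z => by
        refine ENNReal.div_le_of_le_mul (le_mul_of_one_le_right' (one_le_pow₀ ?_))
        rw [ENNReal.one_le_ofReal]
        linarith [norm_nonneg (x - z)]) x
    simpa using this
  -- Second pass, without weight: `F` is now known to be bounded, so the constant depends on `C₁`,
  -- `C₂` and `t` only.
  exact le_of_le_convolution (G := fun z => ‖F z‖ₑ) (Ψ := fun z => ‖Φ z‖ₑ) (by fun_prop)
    ht hC₁ hC₁' hC₂ hint hsup hB hFB hconv (hw.volume_le ht.le fun _ => le_rfl) y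

end Nikolskii

/-! ### Tempered distributions under the integral sign. -/

section SchwartzIntegral

variable {n : ℕ}

/-- The weighted derivative `u ↦ |u|^k D^l φ(u)` of a Schwartz function, as a bounded continuous
function. -/
def weightedDeriv (k l : ℕ) :
    𝓢(Rn n, ℂ) →L[ℂ] BoundedContinuousFunction (Rn n) (Rn n [×l]→L[ℝ] ℂ) :=
  SchwartzMap.mkCLMtoNormedSpace (𝕜 := ℂ) (σ := RingHom.id ℂ)
    (fun φ => BoundedContinuousFunction.ofNormedAddCommGroup
      (fun u => (‖u‖ ^ k : ℝ) • iteratedFDeriv ℝ l φ u)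
      (by
        have := (φ.smooth ⊤).continuous_iteratedFDeriv (m := l) (mod_cast le_top)
        fun_prop)
      (SchwartzMap.seminorm ℂ k l φ)
      (fun u => by
        rw [norm_smul, Real.norm_of_nonneg (by positivity)]
        exact SchwartzMap.le_seminorm ℂ k l φ u))
    (fun φ₁ φ₂ => by
      ext1 u
      have h := iteratedFDeriv_add_apply (𝕜 := ℝ) (i := l) (x := u)
        ((φ₁.smooth l).contDiffAt) ((φ₂.smooth l).contDiffAt)
      simp only [BoundedContinuousFunction.coe_ofNormedAddCommGroup,
        BoundedContinuousFunction.coe_add, Pi.add_apply, FunLike.coe_add]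
      rw [h, smul_add])
    (fun a φ => by
      ext1 u
      have h := iteratedFDeriv_const_smul_apply (𝕜 := ℝ) (i := l) (x := u) (a := a)
        ((φ.smooth l).contDiffAt)
      rw [BoundedContinuousFunction.coe_ofNormedAddCommGroup, BoundedContinuousFunction.coe_smul,
        BoundedContinuousFunction.coe_ofNormedAddCommGroup, FunLike.coe_smul, h, smul_comm]
      rfl)
    ⟨{(k, l)}, 1, zero_le_one, fun φ => by
      simp only [one_mul, Finset.sup_singleton]
      refine BoundedContinuousFunction.norm_ofNormedAddCommGroup_le _ (by positivity) _⟩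

theorem weightedDeriv_apply (k l : ℕ) (φ : 𝓢(Rn n, ℂ)) (u : Rn n) :
    weightedDeriv k l φ u = (‖u‖ ^ k : ℝ) • iteratedFDeriv ℝ l φ u := rfl

theorem norm_weightedDeriv (k l : ℕ) (φ : 𝓢(Rn n, ℂ)) :
    ‖weightedDeriv k l φ‖ = SchwartzMap.seminorm ℂ k l φ := by
  refine le_antisymm (BoundedContinuousFunction.norm_ofNormedAddCommGroup_le
    (f := fun u => (‖u‖ ^ k : ℝ) • iteratedFDeriv ℝ l φ u) _ (by positivity) (fun u => by
      rw [norm_smul, Real.norm_of_nonneg (by positivity)]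
      exact SchwartzMap.le_seminorm ℂ k l φ u)) ?_
  refine SchwartzMap.seminorm_le_bound ℂ k l φ (norm_nonneg (weightedDeriv k l φ)) fun u => ?_
  refine le_trans (le_of_eq ?_) ((weightedDeriv k l φ).norm_coe_le_norm u)
  rw [weightedDeriv_apply, norm_smul, Real.norm_of_nonneg (by positivity)]

/-- The seminorm bound that expresses the continuity of a tempered distribution. -/
theorem exists_seminorm_bound (f : 𝓢'(Rn n, ℂ)) : ∃ (s : Finset (ℕ × ℕ)) (C : NNReal),
    ∀ φ, ‖f φ‖ ≤ C * (s.sup fun m => SchwartzMap.seminorm ℂ m.1 m.2) φ := by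
  let q : Seminorm ℂ 𝓢(Rn n, ℂ) := (normSeminorm ℂ ℂ).comp f.toLinearMap
  have hq : Continuous q := continuous_norm.comp f.continuous
  obtain ⟨s, C, _, h⟩ := Seminorm.bound_of_continuous (schwartz_withSeminorms ℂ (Rn n) ℂ) q hq
  exact ⟨s, C, fun φ => h φ⟩

/-- A linear functional that is bounded by the norm of a linear map into a normed space factors
through that map. -/
theorem exists_dual_factorization {V X : Type*} [AddCommGroup V] [Module ℂ V]
    [NormedAddCommGroup X] [NormedSpace ℂ X] (f : V →ₗ[ℂ] ℂ) (ι : V →ₗ[ℂ] X) {C : NNReal}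
    (h : ∀ φ, ‖f φ‖ ≤ C * ‖ι φ‖) : ∃ g : StrongDual ℂ X, ∀ φ, g (ι φ) = f φ := by
  -- The bound makes `f` vanish on the kernel of `ι`, so `f` descends to the range of `ι`;
  -- Hahn–Banach extends it from there to all of `X`.
  have hker : LinearMap.ker ι ≤ LinearMap.ker f := fun φ hφ => by
    have := h φ
    rw [LinearMap.mem_ker.1 hφ, norm_zero, mul_zero, norm_le_zero_iff] at this
    exact this
  let g₀ : Module.Dual ℂ (LinearMap.range ι) :=
    ((LinearMap.ker ι).liftQ f hker) ∘ₗ ι.quotKerEquivRange.symm.toLinearMap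
  have hg₀ : ∀ φ, g₀ ⟨ι φ, LinearMap.mem_range_self ι φ⟩ = f φ := fun φ => by
    have : ι.quotKerEquivRange.symm ⟨ι φ, LinearMap.mem_range_self ι φ⟩ =
        (LinearMap.ker ι).mkQ φ := by
      rw [LinearEquiv.symm_apply_eq]; rfl
    simp only [g₀, LinearMap.comp_apply, LinearEquiv.coe_coe, this]
    rfl
  obtain ⟨g, hg, -⟩ := Module.Dual.exists_continuous_extension_of_le_seminorm
    (LinearMap.range ι) g₀ (p := C • normSeminorm ℂ X) (by
      change Continuous fun x => (C : ℝ) * ‖x‖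
      fun_prop) (by
      rintro ⟨_, φ, rfl⟩
      rw [hg₀]
      exact h φ)
  exact ⟨g, fun φ => (hg ⟨ι φ, LinearMap.mem_range_self ι φ⟩).trans (hg₀ φ)⟩

/-- The target of finitely many weighted derivatives. -/
def WeightedSpace (n : ℕ) (s : Finset (ℕ × ℕ)) : Type :=
  ∀ i : s, BoundedContinuousFunction (Rn n) (Rn n [×i.1.2]→L[ℝ] ℂ)

instance (s : Finset (ℕ × ℕ)) : NormedAddCommGroup (WeightedSpace n s) :=
  inferInstanceAs <| NormedAddCommGroup
    (∀ i : s, BoundedContinuousFunction (Rn n) (Rn n [×i.1.2]→L[ℝ] ℂ))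

instance (s : Finset (ℕ × ℕ)) : NormedSpace ℂ (WeightedSpace n s) :=
  inferInstanceAs <| NormedSpace ℂ
    (∀ i : s, BoundedContinuousFunction (Rn n) (Rn n [×i.1.2]→L[ℝ] ℂ))

instance (s : Finset (ℕ × ℕ)) : CompleteSpace (WeightedSpace n s) :=
  inferInstanceAs <| CompleteSpace
    (∀ i : s, BoundedContinuousFunction (Rn n) (Rn n [×i.1.2]→L[ℝ] ℂ))

/-- Finitely many weighted derivatives of a Schwartz function. -/
def weightedDerivs (s : Finset (ℕ × ℕ)) : 𝓢(Rn n, ℂ) →L[ℂ] WeightedSpace n s :=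
  (ContinuousLinearMap.pi fun i => weightedDeriv i.1.1 i.1.2 : 𝓢(Rn n, ℂ) →L[ℂ]
    (∀ i : s, BoundedContinuousFunction (Rn n) (Rn n [×i.1.2]→L[ℝ] ℂ)))

/-- Evaluation of one of the weighted derivatives at a point. -/
def weightedEval (s : Finset (ℕ × ℕ)) (i : s) (u : Rn n) :
    WeightedSpace n s →L[ℂ] (Rn n [×i.1.2]→L[ℝ] ℂ) :=
  (BoundedContinuousFunction.evalCLM ℂ u).comp (ContinuousLinearMap.proj (R := ℂ)
    (φ := fun i : s => BoundedContinuousFunction (Rn n) (Rn n [×i.1.2]→L[ℝ] ℂ)) i)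

theorem weightedEval_weightedDerivs (s : Finset (ℕ × ℕ)) (i : s) (u : Rn n) (φ : 𝓢(Rn n, ℂ)) :
    weightedEval s i u (weightedDerivs s φ) =
      (‖u‖ ^ i.1.1 : ℝ) • iteratedFDeriv ℝ i.1.2 φ u := rfl

theorem WeightedSpace.ext_eval {s : Finset (ℕ × ℕ)} {x y : WeightedSpace n s}
    (h : ∀ i u, weightedEval s i u x = weightedEval s i u y) : x = y :=
  funext fun i => BoundedContinuousFunction.ext fun u => h i u

theorem seminorm_le_norm_weightedDerivs {s : Finset (ℕ × ℕ)} {i : ℕ × ℕ} (hi : i ∈ s)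
    (φ : 𝓢(Rn n, ℂ)) : SchwartzMap.seminorm ℂ i.1 i.2 φ ≤ ‖weightedDerivs s φ‖ := by
  rw [← norm_weightedDeriv]
  exact norm_le_pi_norm
    (fun i : s => (weightedDeriv i.1.1 i.1.2 φ :
      BoundedContinuousFunction (Rn n) (Rn n [×i.1.2]→L[ℝ] ℂ))) ⟨i, hi⟩

theorem norm_weightedDerivs_le (s : Finset (ℕ × ℕ)) (φ : 𝓢(Rn n, ℂ)) :
    ‖weightedDerivs s φ‖ ≤ ∑ i : s, SchwartzMap.seminorm ℂ i.1.1 i.1.2 φ := by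
  refine (pi_norm_le_iff_of_nonneg (x := fun i : s => (weightedDeriv i.1.1 i.1.2 φ :
      BoundedContinuousFunction (Rn n) (Rn n [×i.1.2]→L[ℝ] ℂ)))
    (Finset.sum_nonneg fun _ _ => apply_nonneg _ _)).2 fun i => ?_
  refine (norm_weightedDeriv _ _ _).le.trans ?_
  exact Finset.single_le_sum (f := fun i : s => SchwartzMap.seminorm ℂ i.1.1 i.1.2 φ)
    (fun _ _ => apply_nonneg _ _) (Finset.mem_univ i)

/-- Tempered distributions commute with integrals of Schwartz functions. -/
theorem apply_eq_integral (f : 𝓢'(Rn n, ℂ)) {φ : Rn n → 𝓢(Rn n, ℂ)} (hφ : Continuous φ)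
    {w : Rn n → ℂ} (hw : Continuous w)
    (hint : ∀ k l, Integrable fun y => ‖w y‖ * SchwartzMap.seminorm ℂ k l (φ y)) {χ : 𝓢(Rn n, ℂ)}
    (hχ : ∀ l u, iteratedFDeriv ℝ l χ u = ∫ y, w y • iteratedFDeriv ℝ l (φ y) u) :
    f χ = ∫ y, w y * f (φ y) := by
  obtain ⟨s, C, hf⟩ := exists_seminorm_bound f
  set ι := weightedDerivs (n := n) s with hι
  have hfι : ∀ φ, ‖f φ‖ ≤ C * ‖ι φ‖ := fun φ => by
    refine (hf φ).trans ?_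
    gcongr
    exact Seminorm.finset_sup_apply_le (norm_nonneg _) fun i hi =>
      seminorm_le_norm_weightedDerivs hi φ
  -- By finite order, `f` factors through a Banach space, where the Bochner integral exists and
  -- commutes with `g`.
  obtain ⟨g, hgι⟩ : ∃ g : StrongDual ℂ (WeightedSpace n s), ∀ φ, g (ι φ) = f φ :=
    exists_dual_factorization (C := C) f.toLinearMap ι.toLinearMap hfι
  have hcont : Continuous fun y => w y • ι (φ y) := hw.smul (ι.continuous.comp hφ)
  have hI : Integrable fun y => w y • ι (φ y) := by
    have hsum : Integrable fun y => ∑ i : s, ‖w y‖ * SchwartzMap.seminorm ℂ i.1.1 i.1.2 (φ y) :=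
      integrable_finsetSum _ fun i _ => hint _ _
    refine hsum.mono' hcont.aestronglyMeasurable (.of_forall fun y => ?_)
    rw [norm_smul, ← Finset.mul_sum]
    gcongr
    exact norm_weightedDerivs_le s (φ y)
  -- Point evaluations of the weighted derivatives separate this Banach space, so the pointwise
  -- hypothesis `hχ` identifies the integral.
  have hιχ : ι χ = ∫ y, w y • ι (φ y) := by
    refine WeightedSpace.ext_eval fun i u => ?_
    rw [← (weightedEval s i u).integral_comp_comm hI]
    simp_rw [map_smul, hι, weightedEval_weightedDerivs, smul_comm (w _)]
    rw [integral_smul, ← hχ]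
  rw [← hgι, hιχ, ← g.integral_comp_comm hI]
  simp [hgι]

end SchwartzIntegral

/-! ### The reproducing formula and Nikolskii's inequality for Littlewood–Paley pieces. -/

section Translates

variable {n : ℕ} {ζ : 𝓢(Rn n, ℂ)} {φ : Rn n → 𝓢(Rn n, ℂ)}

theorem iteratedFDeriv_translate (h : ∀ y, (φ y : Rn n → ℂ) = fun u => ζ (u - y)) (l : ℕ)
    (y u : Rn n) : iteratedFDeriv ℝ l (φ y) u = iteratedFDeriv ℝ l ζ (u - y) := by
  rw [h, iteratedFDeriv_comp_sub]

theorem exists_weighted_decay (ζ : 𝓢(Rn n, ℂ)) (k l : ℕ) :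
    ∃ D : ℝ, 0 ≤ D ∧ ∀ v, (1 + ‖v‖) ^ k * ‖iteratedFDeriv ℝ l ζ v‖ ≤ D :=
  ⟨_, by positivity, SchwartzMap.one_add_le_sup_seminorm_apply (𝕜 := ℂ) (m := (k, l)) le_rfl le_rfl ζ⟩

/-- The weight is transferred by `‖u‖ ≤ (1 + ‖u - y‖)(1 + ‖y‖)`. The bound yields both polynomial
growth of the pieces and the integrability needed to integrate under `f`. -/
theorem exists_seminorm_translate_le (h : ∀ y, (φ y : Rn n → ℂ) = fun u => ζ (u - y)) (k l : ℕ) :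
    ∃ D : ℝ, 0 ≤ D ∧ ∀ y, SchwartzMap.seminorm ℂ k l (φ y) ≤ D * (1 + ‖y‖) ^ k := by
  obtain ⟨D, hD0, hD⟩ := exists_weighted_decay ζ k l
  refine ⟨D, hD0, fun y => SchwartzMap.seminorm_le_bound ℂ k l _ (by positivity) fun u => ?_⟩
  rw [iteratedFDeriv_translate h]
  calc ‖u‖ ^ k * ‖iteratedFDeriv ℝ l ζ (u - y)‖
      ≤ ((1 + ‖u - y‖) * (1 + ‖y‖)) ^ k * ‖iteratedFDeriv ℝ l ζ (u - y)‖ := by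
        gcongr
        have : ‖u‖ ≤ ‖u - y‖ + ‖y‖ := by simpa using norm_add_le (u - y) y
        nlinarith [norm_nonneg y, norm_nonneg (u - y)]
    _ = (1 + ‖u - y‖) ^ k * ‖iteratedFDeriv ℝ l ζ (u - y)‖ * (1 + ‖y‖) ^ k := by
        rw [mul_pow]; ring
    _ ≤ _ := by gcongr; exact hD _

/-- Mean value inequality for the `l`-th derivative of `ζ` on the unit ball about `u - y₀`. There
the fixed weight `‖u‖^k` is at most `(1 + ‖z‖)^k` times a factor depending on `y₀`, so the decay of
the next derivative applies. -/
theorem continuous_translate (h : ∀ y, (φ y : Rn n → ℂ) = fun u => ζ (u - y)) : Continuous φ := by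
  refine continuous_iff_continuousAt.2 fun y₀ => ?_
  refine ((schwartz_withSeminorms ℂ (Rn n) ℂ).tendsto_nhds _ _).2 ?_
  rintro ⟨k, l⟩ ε hε
  obtain ⟨D, hD0, hD⟩ := exists_weighted_decay ζ k (l + 1)
  set K := D * (2 + ‖y₀‖) ^ k with hK
  have hK0 : 0 ≤ K := by positivity
  have hbound : ∀ y, ‖y - y₀‖ ≤ 1 → SchwartzMap.seminorm ℂ k l (φ y - φ y₀) ≤ K * ‖y - y₀‖ := by
    intro y hy
    refine SchwartzMap.seminorm_le_bound ℂ k l _ (by positivity) fun u => ?_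
    have e : iteratedFDeriv ℝ l (φ y - φ y₀ : 𝓢(Rn n, ℂ)) u =
        iteratedFDeriv ℝ l ζ (u - y) - iteratedFDeriv ℝ l ζ (u - y₀) := by
      rw [← iteratedFDeriv_translate h, ← iteratedFDeriv_translate h]
      exact iteratedFDeriv_sub_apply ((φ y).smooth l).contDiffAt ((φ y₀).smooth l).contDiffAt
    rw [e]
    have hdiff : Differentiable ℝ (iteratedFDeriv ℝ l ζ) :=
      (ζ.smooth ⊤).differentiable_iteratedFDeriv (mod_cast WithTop.coe_lt_top l)
    have hmv := Convex.norm_image_sub_le_of_norm_fderiv_le (𝕜 := ℝ)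
      (f := fun z => (‖u‖ ^ k : ℝ) • iteratedFDeriv ℝ l ζ z) (C := K)
      (s := Metric.closedBall (u - y₀) 1) (x := u - y₀) (y := u - y)
      (fun z _ => (hdiff z).fun_const_smul _) (fun z hz => ?_) (convex_closedBall _ _)
      (Metric.mem_closedBall_self zero_le_one) (by
        rw [mem_closedBall_iff_norm]; rw [norm_sub_rev] at hy; simpa using hy)
    · rw [← smul_sub, norm_smul, Real.norm_of_nonneg (by positivity)] at hmv
      refine hmv.trans_eq ?_
      rw [sub_sub_sub_cancel_left, norm_sub_rev]
    · rw [fderiv_fun_const_smul (hdiff z), norm_smul, Real.norm_of_nonneg (by positivity),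
        norm_fderiv_iteratedFDeriv]
      have hz' : ‖z - (u - y₀)‖ ≤ 1 := mem_closedBall_iff_norm.1 hz
      have hu : ‖u‖ ≤ (1 + ‖z‖) * (2 + ‖y₀‖) := by
        have : ‖u‖ ≤ ‖z‖ + ‖z - (u - y₀)‖ + ‖y₀‖ := by
          calc ‖u‖ = ‖z - (z - (u - y₀)) + y₀‖ := by congr 1; abel
            _ ≤ ‖z - (z - (u - y₀))‖ + ‖y₀‖ := norm_add_le _ _
            _ ≤ _ := by gcongr; exact norm_sub_le _ _
        nlinarith [norm_nonneg z, norm_nonneg y₀]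
      calc ‖u‖ ^ k * ‖iteratedFDeriv ℝ (l + 1) ζ z‖
          ≤ ((1 + ‖z‖) * (2 + ‖y₀‖)) ^ k * ‖iteratedFDeriv ℝ (l + 1) ζ z‖ := by gcongr
        _ = (1 + ‖z‖) ^ k * ‖iteratedFDeriv ℝ (l + 1) ζ z‖ * (2 + ‖y₀‖) ^ k := by
            rw [mul_pow]; ring
        _ ≤ _ := by rw [hK]; gcongr; exact hD z
  have hev : ∀ᶠ y in nhds y₀, ‖y - y₀‖ < min 1 (ε / (K + 1)) := by
    have : Filter.Tendsto (fun y => ‖y - y₀‖) (nhds y₀) (nhds ‖y₀ - y₀‖) :=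
      (by fun_prop : Continuous fun y => ‖y - y₀‖).tendsto y₀
    rw [sub_self, norm_zero] at this
    exact this.eventually_lt_const (by positivity)
  filter_upwards [hev] with y hy
  refine (hbound y (hy.le.trans (min_le_left _ _))).trans_lt ?_
  have h2 := hy.le.trans (min_le_right _ _)
  calc K * ‖y - y₀‖ ≤ K * (ε / (K + 1)) := by gcongr
    _ < ε := by
      rw [mul_div_assoc', div_lt_iff₀ (by positivity)]
      nlinarith

/-- Derivatives of a Fourier transform are reproduced by kernels whose Fourier transform is `1` on
the support. -/
theorem iteratedFDeriv_fourier_reproducing {ψ Φ : 𝓢(Rn n, ℂ)} (h : ∀ ξ, ψ ξ ≠ 0 → 𝓕 Φ ξ = 1)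
    (l : ℕ) (v : Rn n) : iteratedFDeriv ℝ l (𝓕 ψ : 𝓢(Rn n, ℂ)) v =
      ∫ t, Φ t • iteratedFDeriv ℝ l (𝓕 ψ : 𝓢(Rn n, ℂ)) (v + t) := by
  set H : Rn n → (Rn n [×l]→L[ℝ] ℂ) :=
    fun ξ => VectorFourier.fourierPowSMulRight (innerSL ℝ) (ψ : Rn n → ℂ) ξ l with hH
  have hHi : Integrable H :=
    VectorFourier.integrable_fourierPowSMulRight _ (ψ.integrable_pow_mul volume l)
      ψ.continuous.aestronglyMeasurable
  have e : iteratedFDeriv ℝ l (𝓕 ψ : 𝓢(Rn n, ℂ)) = 𝓕 H := by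
    rw [SchwartzMap.fourier_coe]
    exact Real.iteratedFDeriv_fourier (N := ⊤) (fun m _ => ψ.integrable_pow_mul volume m)
      ψ.continuous.aestronglyMeasurable (mod_cast le_top)
  rw [e]
  -- `G` is `H` modulated by `v`, so that `𝓕 G t = 𝓕 H (v + t)`. Moving the Fourier transform from
  -- `Φ` to `G` gives the formula, because `𝓕 Φ = 1` wherever `H` does not vanish.
  set G : Rn n → (Rn n [×l]→L[ℝ] ℂ) := fun ξ => Real.fourierChar (-inner ℝ ξ v) • H ξ with hG
  have hGi : Integrable G := (Real.fourierIntegral_convergent_iff v).2 hHi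
  have hflip : ∫ ξ, 𝓕 (Φ : Rn n → ℂ) ξ • G ξ = ∫ t, Φ t • 𝓕 G t := by
    have := VectorFourier.integral_fourierIntegral_smul_eq_flip (μ := volume) (ν := volume)
      (L := innerₗ (Rn n)) (f := Φ) (g := G) Real.continuous_fourierChar continuous_inner
      (Φ.integrable (μ := volume)) hGi
    rwa [flip_innerₗ] at this
  have hleft : ∫ ξ, 𝓕 (Φ : Rn n → ℂ) ξ • G ξ = 𝓕 H v := by
    rw [Real.fourier_eq]
    refine integral_congr_ae (.of_forall fun ξ => ?_)
    change 𝓕 (Φ : Rn n → ℂ) ξ • G ξ = G ξ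
    by_cases hξ : ψ ξ = 0
    · ext m
      have hm : H ξ m = 0 := by simp [hH, hξ]
      change 𝓕 (Φ : Rn n → ℂ) ξ • (Real.fourierChar (-inner ℝ ξ v) • H ξ m) =
        Real.fourierChar (-inner ℝ ξ v) • H ξ m
      rw [hm, smul_zero, smul_zero]
    · rw [← SchwartzMap.fourier_coe, h ξ hξ, one_smul]
  rw [← hleft, hflip]
  refine integral_congr_ae (.of_forall fun t => ?_)
  change Φ t • 𝓕 G t = Φ t • 𝓕 H (v + t)
  congr 1
  rw [Real.fourier_eq, Real.fourier_eq]
  refine integral_congr_ae (.of_forall fun ξ => ?_)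
  simp only [hG, smul_smul]
  rw [← AddChar.map_add_eq_mul, inner_add_right]
  congr 2
  ring

/-- The reflection in the kernel cancels the one relating `𝓕⁻` to `𝓕`: all kernels of a given piece
are translates of one Schwartz function. -/
theorem coe_reflectTranslate_fourierInv (ψ : 𝓢(Rn n, ℂ)) (y : Rn n) :
    (reflectTranslate (𝓕⁻ ψ) y : Rn n → ℂ) = fun u => (𝓕 ψ : 𝓢(Rn n, ℂ)) (u - y) := by
  funext u
  rw [reflectTranslate_apply, SchwartzMap.fourierInv_apply_eq]
  simp

theorem exists_norm_apply_translate_le (h : ∀ y, (φ y : Rn n → ℂ) = fun u => ζ (u - y))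
    (f : 𝓢'(Rn n, ℂ)) : ∃ (K : ℝ) (N : ℕ), ∀ y, ‖f (φ y)‖ ≤ K * (1 + ‖y‖) ^ N := by
  obtain ⟨s, C, hf⟩ := exists_seminorm_bound f
  choose D hD0 hD using exists_seminorm_translate_le h
  refine ⟨C * ∑ i ∈ s, D i.1 i.2, ∑ i ∈ s, i.1, fun y => (hf _).trans ?_⟩
  rw [mul_assoc]
  gcongr
  have hs0 : 0 ≤ ∑ i ∈ s, D i.1 i.2 := Finset.sum_nonneg fun i _ => hD0 _ _
  refine Seminorm.finset_sup_apply_le (by positivity) fun i hi => (hD _ _ y).trans ?_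
  gcongr
  · exact Finset.single_le_sum (f := fun i : ℕ × ℕ => D i.1 i.2) (fun i _ => hD0 _ _) hi
  · linarith [norm_nonneg y]
  · exact Finset.single_le_sum (f := fun i : ℕ × ℕ => i.1) (fun i _ => Nat.zero_le _) hi

/-- The reproducing formula for a frequency-localized piece of a tempered distribution. -/
theorem apply_reflectTranslate_reproducing {ψ Φ : 𝓢(Rn n, ℂ)} (h : ∀ ξ, ψ ξ ≠ 0 → 𝓕 Φ ξ = 1)
    (f : 𝓢'(Rn n, ℂ)) (x : Rn n) : f (reflectTranslate (𝓕⁻ ψ) x) =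
      ∫ y, f (reflectTranslate (𝓕⁻ ψ) y) * Φ (x - y) := by
  have hφ := coe_reflectTranslate_fourierInv ψ
  have hc := continuous_translate hφ
  have := apply_eq_integral f hc (w := fun y => Φ (x - y)) (by fun_prop) (χ := reflectTranslate (𝓕⁻ ψ) x)
    (fun k l => ?_) (fun l u => ?_)
  · rw [this]; simp_rw [mul_comm]
  · obtain ⟨D, hD0, hD⟩ := exists_seminorm_translate_le hφ k l
    have hcs : Continuous fun y => SchwartzMap.seminorm ℂ k l (reflectTranslate (𝓕⁻ ψ) y) :=
      ((schwartz_withSeminorms ℂ (Rn n) ℂ).continuous_seminorm (k, l)).comp hc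
    refine (((integrable_one_add_pow_mul Φ k).comp_sub_left x).const_mul (D * (1 + ‖x‖) ^ k)).mono'
      (by fun_prop) (.of_forall fun y => ?_)
    rw [Real.norm_of_nonneg (by positivity)]
    calc _ ≤ ‖Φ (x - y)‖ * (D * ((1 + ‖x‖) * (1 + ‖x - y‖)) ^ k) := by
          gcongr
          refine (hD y).trans ?_
          gcongr
          have : ‖y‖ ≤ ‖x‖ + ‖x - y‖ := by
            calc ‖y‖ = ‖x - (x - y)‖ := by congr 1; abel
              _ ≤ _ := norm_sub_le _ _
          nlinarith [norm_nonneg x, norm_nonneg (x - y)]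
      _ = _ := by rw [mul_pow]; ring
  · simp_rw [iteratedFDeriv_translate hφ]
    rw [iteratedFDeriv_fourier_reproducing h, ← integral_sub_left_eq_self _ volume x]
    refine integral_congr_ae (.of_forall fun y => ?_)
    simp only
    congr 2
    abel

/-- Radius `2` contains the support of `ψ 0` and the rescaled supports `2^{-j} supp ψ_j`, so dilates
of one kernel serve every `j`. -/
theorem exists_fourier_eq_one (n : ℕ) : ∃ Φ : 𝓢(Rn n, ℂ), ∀ ξ, ‖ξ‖ ≤ 2 → 𝓕 Φ ξ = 1 := by
  let b : ContDiffBump (0 : Rn n) := ⟨2, 3, by norm_num, by norm_num⟩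
  have hs : HasCompactSupport fun ξ => (b ξ : ℂ) := b.hasCompactSupport.comp_left (g := ((↑) : ℝ → ℂ)) Complex.ofReal_zero
  have hd : ContDiff ℝ ((⊤ : ℕ∞) : WithTop ℕ∞) fun ξ => (b ξ : ℂ) :=
    Complex.ofRealCLM.contDiff.comp b.contDiff
  obtain ⟨χ, hχ⟩ : ∃ χ : 𝓢(Rn n, ℂ), ∀ ξ, χ ξ = (b ξ : ℂ) := ⟨hs.toSchwartzMap hd, fun _ => rfl⟩
  refine ⟨𝓕⁻ χ, fun ξ hξ => ?_⟩
  rw [FourierTransform.fourier_fourierInv_eq, hχ, b.one_of_mem_closedBall (by simpa [b] using hξ)]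
  simp

/-- The kernel `R^n Φ(R x)`. -/
def dilate (R : ℝˣ) (Φ : 𝓢(Rn n, ℂ)) : 𝓢(Rn n, ℂ) :=
  (((R : ℝ) ^ n : ℝ) : ℂ) •
    SchwartzMap.compCLMOfContinuousLinearEquiv ℂ (ContinuousLinearEquiv.smulLeft R) Φ

theorem dilate_apply (R : ℝˣ) (Φ : 𝓢(Rn n, ℂ)) (x : Rn n) :
    dilate R Φ x = (((R : ℝ) ^ n : ℝ) : ℂ) * Φ ((R : ℝ) • x) := rfl

theorem fourier_dilate {R : ℝˣ} (hR : 0 < (R : ℝ)) (Φ : 𝓢(Rn n, ℂ)) (ξ : Rn n) :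
    𝓕 (dilate R Φ) ξ = 𝓕 Φ ((R : ℝ)⁻¹ • ξ) := by
  rw [SchwartzMap.fourier_coe, SchwartzMap.fourier_coe, Real.fourier_eq, Real.fourier_eq]
  have h := Measure.integral_comp_smul_of_nonneg volume
    (fun x => Real.fourierChar (-inner ℝ x ((R : ℝ)⁻¹ • ξ)) • Φ x) (R : ℝ) (hR := hR.le)
  rw [finrank_euclideanSpace_fin] at h
  have hne : (R : ℝ) ^ n ≠ 0 := by positivity
  rw [← inv_smul_smul₀ (inv_ne_zero hne) (∫ x, Real.fourierChar (-inner ℝ x ((R : ℝ)⁻¹ • ξ)) • Φ x),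
    ← h, inv_inv, ← integral_smul]
  refine integral_congr_ae (.of_forall fun x => ?_)
  simp only [dilate_apply, inner_smul_left, inner_smul_right]
  rw [smul_comm, Complex.real_smul]
  congr 3
  simp

theorem lintegral_dilate {R : ℝˣ} (hR : 0 < (R : ℝ)) (Φ : 𝓢(Rn n, ℂ)) :
    ∫⁻ x, ‖dilate R Φ x‖ₑ = ∫⁻ x, ‖Φ x‖ₑ := by
  have h1 : ∀ Φ : 𝓢(Rn n, ℂ), ∫⁻ x, ‖Φ x‖ₑ = ENNReal.ofReal (∫ x, ‖Φ x‖) := fun Φ => by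
    rw [ofReal_integral_norm_eq_lintegral_enorm (Φ.integrable (μ := volume))]
  rw [h1, h1]
  congr 1
  have h := Measure.integral_comp_smul_of_nonneg volume (fun x => ‖Φ x‖) (R : ℝ) (hR := hR.le)
  rw [finrank_euclideanSpace_fin] at h
  have hne : (R : ℝ) ^ n ≠ 0 := by positivity
  simp_rw [dilate_apply, norm_mul]
  rw [integral_const_mul, h, Complex.norm_real, Real.norm_of_nonneg (by positivity), smul_eq_mul,
    mul_inv_cancel_left₀ hne]

/-- **Nikolskii's inequality** for Littlewood–Paley pieces, from weak `L^p` to `L^∞`. -/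
theorem exists_enorm_lpPiece_le {ψ : ℕ → 𝓢(Rn n, ℂ)} (hψ : IsDyadicResolution ψ) {t : ℝ}
    (ht : 0 < t) : ∃ C : ℝ≥0∞, C ≠ ∞ ∧ ∀ (j : ℕ) (f : 𝓢'(Rn n, ℂ)) (A : ℝ≥0∞), A ≠ ∞ →
      WeakBound t (lpPiece ψ j f) A →
      ∀ x, ‖lpPiece ψ j f x‖ₑ ≤ C * 2 ^ ((j : ℝ) * (n * t)) * A := by
  obtain ⟨Φ, hΦ⟩ := exists_fourier_eq_one n
  obtain ⟨S, hS0, hS⟩ := exists_weighted_decay Φ 0 0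
  have hI : ∫⁻ x, ‖Φ x‖ₑ ≠ ∞ := (Φ.integrable (μ := volume)).2.ne
  refine ⟨2 * (1 + ∫⁻ x, ‖Φ x‖ₑ) * (2 * ENNReal.ofReal S) ^ t,
    ENNReal.mul_ne_top (ENNReal.mul_ne_top (by simp) (by simp [hI]))
      (ENNReal.rpow_ne_top_of_nonneg ht.le (ENNReal.mul_ne_top (by simp) (by simp))),
    fun j f A hA hw x => ?_⟩
  -- Dilation by `2^j` keeps the `L¹` norm and multiplies the sup norm by `2^{jn}`; only the latter
  -- enters, to the power `t`, which produces `2^{jnt}`.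
  set R : ℝˣ := Units.mk0 (2 ^ j : ℝ) (by positivity) with hR
  have hRv : (R : ℝ) = 2 ^ j := rfl
  have hR0 : 0 < (R : ℝ) := by rw [hRv]; positivity
  have hker : ∀ ξ, ψ j ξ ≠ 0 → 𝓕 (dilate R Φ) ξ = 1 := fun ξ hξ => by
    rw [fourier_dilate hR0]
    refine hΦ _ ?_
    have hmem : ξ ∈ tsupport (ψ j : Rn n → ℂ) := subset_tsupport _ hξ
    rw [norm_smul, norm_inv, hRv, Real.norm_of_nonneg (by positivity), inv_mul_le_iff₀ (by positivity)]
    rcases Nat.eq_zero_or_pos j with rfl | hj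
    · simpa using hψ.supp_zero hmem
    · refine (hψ.supp_pos j hj hmem).2.trans_eq ?_
      rw [Real.rpow_add (by norm_num), Real.rpow_natCast, Real.rpow_one]
  have hrep := apply_reflectTranslate_reproducing hker f
  have hcont : Continuous (lpPiece ψ j f) :=
    f.continuous.comp (continuous_translate (coe_reflectTranslate_fourierInv (ψ j)))
  obtain ⟨K, N, hKN⟩ :=
    exists_norm_apply_translate_le (coe_reflectTranslate_fourierInv (ψ j)) f
  have hsup : ∀ z, ‖dilate R Φ z‖ₑ ≤ ENNReal.ofReal S * 2 ^ ((j : ℝ) * n) := fun z => by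
    rw [dilate_apply, enorm_mul, mul_comm]
    gcongr
    · rw [← ofReal_norm]
      exact ENNReal.ofReal_le_ofReal (by simpa using hS ((R : ℝ) • z))
    · rw [← ofReal_norm, Complex.norm_real, Real.norm_of_nonneg (by positivity), hRv, ← pow_mul,
        ENNReal.ofReal_pow (by norm_num), ENNReal.ofReal_ofNat, ← ENNReal.rpow_natCast]
      push_cast
      rfl
  refine (enorm_le_of_reproducing hcont hrep hKN ht (C₁ := 1 + ∫⁻ x, ‖Φ x‖ₑ) le_self_add
    (by simp [hI])
    (ENNReal.mul_ne_top (by simp) (ENNReal.rpow_ne_top_of_nonneg (by positivity) (by simp)))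
    ((lintegral_dilate hR0 Φ).le.trans le_add_self) hsup hA hw x).trans_eq ?_
  rw [← mul_assoc 2 (ENNReal.ofReal S), ENNReal.mul_rpow_of_nonneg _ _ ht.le, ← ENNReal.rpow_mul]
  simp only [mul_assoc]

end Translates

/-! ### The estimate for a single block and its two-sided summation. -/

section Blocks

variable {n : ℕ}

theorem interpExp_self {θ : ℝ} (h0 : 0 ≤ θ) (h1 : θ ≤ 1) (p : ℝ≥0∞) : interpExp θ p p = p := by
  rw [← inv_inj, interpExp_inv, ← add_mul, ← ENNReal.ofReal_add (by linarith) h0]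
  simp

theorem interpExp_le_max {θ : ℝ} (h0 : 0 ≤ θ) (h1 : θ ≤ 1) (q₁ q₂ : ℝ≥0∞) :
    interpExp θ q₁ q₂ ≤ max q₁ q₂ := by
  rw [← ENNReal.inv_le_inv, interpExp_inv]
  calc (max q₁ q₂)⁻¹ = ENNReal.ofReal (1 - θ) * (max q₁ q₂)⁻¹ + ENNReal.ofReal θ * (max q₁ q₂)⁻¹ := by
        rw [← add_mul, ← ENNReal.ofReal_add (by linarith) h0]; simp
    _ ≤ _ := by
      gcongr
      · exact le_max_left _ _
      · exact le_max_right _ _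

theorem toReal_inv_inj {p p' : ℝ≥0∞} (hp : 1 ≤ p) (hp' : 1 ≤ p') :
    (p⁻¹).toReal = (p'⁻¹).toReal ↔ p = p' := by
  rw [ENNReal.toReal_eq_toReal_iff' (by simp; positivity) (by simp; positivity), inv_inj]

theorem toReal_inv_lt {p p' : ℝ≥0∞} (hp : 1 ≤ p) (hp' : 1 ≤ p') :
    (p⁻¹).toReal < (p'⁻¹).toReal ↔ p' < p := by
  rw [ENNReal.toReal_lt_toReal (by simp; positivity) (by simp; positivity), ENNReal.inv_lt_inv]

theorem toReal_inv_pos {p : ℝ≥0∞} (hp : 1 ≤ p) : 0 < (p⁻¹).toReal ↔ p ≠ ∞ := by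
  rw [ENNReal.toReal_pos_iff]
  simp only [ENNReal.inv_pos, ENNReal.inv_lt_top, ne_eq, and_iff_left_iff_imp]
  exact fun _ => by positivity

theorem const_mul_interp (c a b : ℝ≥0∞) {θ : ℝ} (h0 : 0 ≤ θ) (h1 : θ ≤ 1) :
    (c * a) ^ (1 - θ) * (c * b) ^ θ = c * (a ^ (1 - θ) * b ^ θ) := by
  have hθ : 0 ≤ 1 - θ := by linarith
  rw [ENNReal.mul_rpow_of_nonneg _ _ hθ, ENNReal.mul_rpow_of_nonneg _ _ h0, mul_mul_mul_comm,
    ← ENNReal.rpow_add_of_nonneg _ _ hθ h0]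
  simp

theorem interp_ne_top {a b : ℝ≥0∞} (ha : a ≠ ∞) (hb : b ≠ ∞) {θ : ℝ} (h0 : 0 ≤ θ) (h1 : θ ≤ 1) :
    a ^ (1 - θ) * b ^ θ ≠ ∞ :=
  ENNReal.mul_ne_top (ENNReal.rpow_ne_top_of_nonneg (by linarith) ha)
    (ENNReal.rpow_ne_top_of_nonneg h0 hb)

theorem two_rpow_ne_top (x : ℝ) : (2 : ℝ≥0∞) ^ x ≠ ∞ :=
  ENNReal.rpow_ne_top_of_ne_zero (by simp) (by simp)

theorem two_rpow_add (x y : ℝ) : (2 : ℝ≥0∞) ^ (x + y) = 2 ^ x * 2 ^ y :=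
  ENNReal.rpow_add _ _ (by simp) (by simp)

/-- Nikolskii's inequality for Littlewood–Paley pieces, from weak `L^{1/t₀}` to `L^{p,q}`. -/
theorem exists_lorentzNorm_lpPiece_le {ψ : ℕ → 𝓢(Rn n, ℂ)} (hψ : IsDyadicResolution ψ) {t₀ : ℝ}
    {p q : ℝ≥0∞} (hp : 1 ≤ p) (hq : 1 ≤ q) (hpq : p = ∞ → q = ∞) (ht : (p⁻¹).toReal < t₀) :
    ∃ C : ℝ≥0∞, C ≠ ∞ ∧ ∀ (j : ℕ) (f : 𝓢'(Rn n, ℂ)) (A : ℝ≥0∞), A ≠ ∞ →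
      WeakBound t₀ (lpPiece ψ j f) A →
      lorentzNorm p q (lpPiece ψ j f) ≤ C * 2 ^ ((j : ℝ) * (n * (t₀ - (p⁻¹).toReal))) * A := by
  have hp0 : 0 ≤ (p⁻¹).toReal := ENNReal.toReal_nonneg
  have ht₀ : 0 < t₀ := hp0.trans_lt ht
  obtain ⟨C, hC, H⟩ := exists_enorm_lpPiece_le hψ ht₀
  have hweak : ∀ (j : ℕ) (f : 𝓢'(Rn n, ℂ)) (A : ℝ≥0∞), A ≠ ∞ → WeakBound t₀ (lpPiece ψ j f) A →
      WeakBound 0 (lpPiece ψ j f) (C * 2 ^ ((j : ℝ) * (n * t₀)) * A) := by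
    intro j f A hA hw α _ hα
    obtain ⟨x, hx⟩ : {x : Rn n | α < ‖lpPiece ψ j f x‖}.Nonempty := by
      rw [nonempty_iff_ne_empty]
      intro h
      exact hα (by rw [distribFun, h, measure_empty])
    simp only [lorentzFn, ENNReal.rpow_zero, mul_one]
    refine le_trans ?_ (H j f A hA hw x)
    rw [← ofReal_norm]
    exact ENNReal.ofReal_le_ofReal (le_of_lt hx)
  by_cases hp' : p = ∞
  · obtain rfl := hpq hp'
    subst hp'
    refine ⟨C, hC, fun j f A hA hw => ?_⟩
    simpa using lorentzNorm_top_le (hweak j f A hA hw)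
  · have hpos := (toReal_inv_pos hp).2 hp'
    set t := (p⁻¹).toReal with htd
    have hd : 0 < t / t₀ := by positivity
    have hd1 : t / t₀ < 1 := (div_lt_one ht₀).2 ht
    -- Interpolate between weak `L^{1/t₀}` and `L^∞`. The powers of `A` recombine to `A`, and the
    -- Nikolskii factor becomes `2^{jn t₀ (1 - t/t₀)} = 2^{jn(t₀ - t)}`.
    obtain ⟨C', hC', H'⟩ := lorentzNorm_le_of_weakBound (n := n) (θ := 1 - t / t₀) ht₀.le le_rfl
      ht₀.ne' (by linarith) (by linarith) hp' hq (by rw [← htd]; field_simp; ring)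
    have hd0 : 0 ≤ 1 - t / t₀ := by linarith
    refine ⟨C' * C ^ (1 - t / t₀), ENNReal.mul_ne_top hC' (ENNReal.rpow_ne_top_of_nonneg hd0 hC),
      fun j f A hA hw => ?_⟩
    refine (H' _ A _ hA (ENNReal.mul_ne_top (ENNReal.mul_ne_top hC (two_rpow_ne_top _)) hA) hw
      (hweak j f A hA hw)).trans_eq ?_
    rw [ENNReal.mul_rpow_of_nonneg _ _ hd0, ENNReal.mul_rpow_of_nonneg _ _ hd0, ← ENNReal.rpow_mul,
      sub_sub_cancel]
    have e1 : A ^ (t / t₀) * A ^ (1 - t / t₀) = A := by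
      rw [← ENNReal.rpow_add_of_nonneg _ _ hd.le hd0]; simp
    have e2 : (j : ℝ) * (n * t₀) * (1 - t / t₀) = (j : ℝ) * (n * (t₀ - t)) := by
      field_simp
    rw [e2]
    calc _ = C' * C ^ (1 - t / t₀) * 2 ^ ((j : ℝ) * (n * (t₀ - t))) *
          (A ^ (t / t₀) * A ^ (1 - t / t₀)) := by ring
      _ = _ := by rw [e1]

/-- The relations between the exponents under which a single Littlewood–Paley piece satisfies the
interpolation inequality. -/
def BlockCondition (θ : ℝ) (p p₁ p₂ q q₁ q₂ : ℝ≥0∞) : Prop :=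
  interpExp θ p₁ p₂ < p ∨ (interpExp θ p₁ p₂ = p ∧ (p₁ ≠ p₂ ∨ interpExp θ q₁ q₂ ≤ q))

theorem exists_block_bound {ψ : ℕ → 𝓢(Rn n, ℂ)} (hψ : IsDyadicResolution ψ) {θ : ℝ} (h0 : 0 < θ)
    (h1 : θ < 1) {p p₁ p₂ q q₁ q₂ : ℝ≥0∞} (hp : 1 ≤ p) (hp₁ : 1 ≤ p₁) (hp₂ : 1 ≤ p₂)
    (hq : 1 ≤ q) (hq₁ : 1 ≤ q₁) (hq₂ : 1 ≤ q₂)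
    (hpq : p = ∞ → q = ∞) (hpq₁ : p₁ = ∞ → q₁ = ∞) (hpq₂ : p₂ = ∞ → q₂ = ∞)
    (hc : BlockCondition θ p p₁ p₂ q q₁ q₂) :
    ∃ C : ℝ≥0∞, C ≠ ∞ ∧ ∀ (j : ℕ) (f : 𝓢'(Rn n, ℂ)), lorentzNorm p₁ q₁ (lpPiece ψ j f) ≠ ∞ →
      lorentzNorm p₂ q₂ (lpPiece ψ j f) ≠ ∞ → lorentzNorm p q (lpPiece ψ j f) ≤
        C * 2 ^ ((j : ℝ) * (n * ((1 - θ) * (p₁⁻¹).toReal + θ * (p₂⁻¹).toReal - (p⁻¹).toReal))) *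
          (lorentzNorm p₁ q₁ (lpPiece ψ j f) ^ (1 - θ) *
            lorentzNorm p₂ q₂ (lpPiece ψ j f) ^ θ) := by
  have hps := one_le_interpExp h0.le h1.le hp₁ hp₂
  have hts := interpExp_inv_toReal h0.le h1.le hp₁ hp₂
  have four : ∀ {a : ℝ≥0∞}, a ≠ ∞ → 4 * a ≠ ∞ := fun ha => ENNReal.mul_ne_top (by simp) ha
  rcases hc with hc | ⟨hc, hc'⟩
  · obtain ⟨C, hC, H⟩ := exists_lorentzNorm_lpPiece_le hψ hp hq hpq ((toReal_inv_lt hp hps).2 hc)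
    refine ⟨C * 4, ENNReal.mul_ne_top hC (by simp), fun j f ha hb => ?_⟩
    have w := (weakBound_lorentzNorm hp₁ hq₁ hpq₁ (lpPiece ψ j f)).interp ENNReal.toReal_nonneg
      ENNReal.toReal_nonneg h0.le h1.le (weakBound_lorentzNorm hp₂ hq₂ hpq₂ (lpPiece ψ j f))
    rw [← hts] at w
    refine (H j f _ (interp_ne_top (four ha) (four hb) h0.le h1.le) w).trans_eq ?_
    rw [const_mul_interp _ _ _ h0.le h1.le, hts]
    ring
  · rw [hc] at hts
    by_cases hne : p₁ = p₂
    · obtain rfl : p₁ = p := by rw [← hne, interpExp_self h0.le h1.le] at hc; exact hc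
      subst hne
      have hq' := hc'.resolve_left (by simp)
      refine ⟨4, by simp, fun j f _ _ => ?_⟩
      rw [← hts, sub_self, mul_zero, mul_zero, ENNReal.rpow_zero, mul_one]
      refine (lorentzNorm_le_of_le hp (one_le_interpExp h0.le h1.le hq₁ hq₂) hq' (fun h => ?_)
        _).trans ?_
      · rw [interpExp_eq_top h0 h1]; exact ⟨hpq₁ h, hpq₂ h⟩
      · gcongr
        exact lorentzNorm_interp h0 h1 hq₁ hq₂ hpq₁ hpq₂ _
    · have hp' : p ≠ ∞ := by
        rintro rfl
        obtain ⟨rfl, rfl⟩ := (interpExp_eq_top h0 h1).1 hc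
        exact hne rfl
      obtain ⟨C, hC, H⟩ := lorentzNorm_le_of_weakBound (n := n) (ENNReal.toReal_nonneg)
        (ENNReal.toReal_nonneg) (fun h => hne ((toReal_inv_inj hp₁ hp₂).1 h)) h0 h1 hp' hq hts
      refine ⟨C * 4, ENNReal.mul_ne_top hC (by simp), fun j f ha hb => ?_⟩
      rw [← hts, sub_self, mul_zero, mul_zero, ENNReal.rpow_zero, mul_one]
      refine (H _ _ _ (four ha) (four hb) (weakBound_lorentzNorm hp₁ hq₁ hpq₁ (lpPiece ψ j f))
        (weakBound_lorentzNorm hp₂ hq₂ hpq₂ (lpPiece ψ j f))).trans_eq ?_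
      rw [const_mul_interp _ _ _ h0.le h1.le, mul_assoc]

/-- The weighted norms of the Littlewood–Paley pieces, whose `ℓ^r` norm is the Besov–Lorentz norm. -/
def weightedPiece (ψ : ℕ → 𝓢(Rn n, ℂ)) (s : ℝ) (p q : ℝ≥0∞) (f : 𝓢'(Rn n, ℂ)) (j : ℕ) : ℝ≥0∞ :=
  2 ^ ((j : ℝ) * s) * lorentzNorm p q (lpPiece ψ j f)

theorem weightedPiece_le {ψ : ℕ → 𝓢(Rn n, ℂ)} {s : ℝ} {p q r : ℝ≥0∞} (hr : 1 ≤ r)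
    (f : 𝓢'(Rn n, ℂ)) (j : ℕ) : weightedPiece ψ s p q f j ≤ besovLorentzNorm ψ s p q r f :=
  le_seqNorm hr _ j

/-- The exponent is written through the numbers `s - n/p`, so it is affine in `θ`; perturbing `θ` by
`ε` shifts it by a multiple of `ε`. -/
theorem exists_weightedPiece_bound {ψ : ℕ → 𝓢(Rn n, ℂ)} (hψ : IsDyadicResolution ψ) {θ : ℝ}
    (h0 : 0 < θ) (h1 : θ < 1) (s s₁ s₂ : ℝ) {p p₁ p₂ q q₁ q₂ r₁ r₂ : ℝ≥0∞}
    (hp : 1 ≤ p) (hp₁ : 1 ≤ p₁) (hp₂ : 1 ≤ p₂) (hq : 1 ≤ q) (hq₁ : 1 ≤ q₁) (hq₂ : 1 ≤ q₂)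
    (hr₁ : 1 ≤ r₁) (hr₂ : 1 ≤ r₂)
    (hpq : p = ∞ → q = ∞) (hpq₁ : p₁ = ∞ → q₁ = ∞) (hpq₂ : p₂ = ∞ → q₂ = ∞)
    (hc : BlockCondition θ p p₁ p₂ q q₁ q₂) :
    ∃ C : ℝ≥0∞, C ≠ ∞ ∧
      ∀ f ∈ besovLorentzSpace ψ s₁ p₁ q₁ r₁ ∩ besovLorentzSpace ψ s₂ p₂ q₂ r₂, ∀ j : ℕ,
        weightedPiece ψ s p q f j ≤
          C * 2 ^ ((j : ℝ) * ((s - n * (p⁻¹).toReal) -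
            ((1 - θ) * (s₁ - n * (p₁⁻¹).toReal) + θ * (s₂ - n * (p₂⁻¹).toReal)))) *
          (weightedPiece ψ s₁ p₁ q₁ f j ^ (1 - θ) * weightedPiece ψ s₂ p₂ q₂ f j ^ θ) := by
  obtain ⟨C, hC, H⟩ := exists_block_bound hψ h0 h1 hp hp₁ hp₂ hq hq₁ hq₂ hpq hpq₁ hpq₂ hc
  have hθ : 0 ≤ 1 - θ := by linarith
  have hfin : ∀ {s p q r} {f : 𝓢'(Rn n, ℂ)}, 1 ≤ r → f ∈ besovLorentzSpace ψ s p q r → ∀ j,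
      lorentzNorm p q (lpPiece ψ j f) ≠ ∞ := fun hr hf j h => by
    have := (weightedPiece_le hr _ j).trans_lt hf
    rw [weightedPiece, h, ENNReal.mul_top] at this
    · exact absurd this (by simp)
    · exact (ENNReal.rpow_pos (by simp) (by simp)).ne'
  refine ⟨C, hC, fun f hf j => ?_⟩
  unfold weightedPiece
  refine (mul_le_mul_right (H j f (hfin hr₁ hf.1 j) (hfin hr₂ hf.2 j)) _).trans_eq ?_
  rw [ENNReal.mul_rpow_of_nonneg _ _ hθ, ENNReal.mul_rpow_of_nonneg _ _ h0.le, ← ENNReal.rpow_mul,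
    ← ENNReal.rpow_mul]
  set a := lorentzNorm p₁ q₁ (lpPiece ψ j f) ^ (1 - θ)
  set b := lorentzNorm p₂ q₂ (lpPiece ψ j f) ^ θ
  have e : ∀ x y z u v : ℝ, x + y = z + u + v → (2 : ℝ≥0∞) ^ x * (C * 2 ^ y * (a * b)) =
      C * 2 ^ z * (2 ^ u * a * (2 ^ v * b)) := fun x y z u v h => by
    calc _ = C * 2 ^ (x + y) * (a * b) := by rw [two_rpow_add]; ring
      _ = _ := by rw [h, two_rpow_add, two_rpow_add]; ring
  refine e _ _ _ _ _ ?_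
  ring

/-- Summation of two geometric bounds with exponents on both sides of the critical one. -/
theorem exists_tsum_le_interp {θ ε D : ℝ} (hε : 0 < ε) (h0 : ε < θ) (h1 : θ + ε < 1) (hD : D ≠ 0)
    {K : ℝ≥0∞} (hK : K ≠ ∞) : ∃ C : ℝ≥0∞, C ≠ ∞ ∧ ∀ (x : ℕ → ℝ≥0∞) (A B : ℝ≥0∞), A ≠ ∞ → B ≠ ∞ →
      (∀ j : ℕ, x j ≤ K * 2 ^ ((j : ℝ) * (ε * D)) * (A ^ (1 - (θ - ε)) * B ^ (θ - ε))) →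
      (∀ j : ℕ, x j ≤ K * 2 ^ ((j : ℝ) * (-(ε * D))) * (A ^ (1 - (θ + ε)) * B ^ (θ + ε))) →
      ∑' j, x j ≤ C * (A ^ (1 - θ) * B ^ θ) := by
  -- Exchanging `A` with `B` and `θ` with `1 - θ` changes the sign of `D`.
  wlog hD0 : 0 < D generalizing θ D
  · obtain ⟨C, hC, H⟩ := this (θ := 1 - θ) (D := -D) (by linarith) (by linarith) (by simpa)
      (by simp only [Left.neg_pos_iff]; exact lt_of_le_of_ne (not_lt.1 hD0) hD)
    refine ⟨C, hC, fun x A B hA hB hx₁ hx₂ => ?_⟩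
    rw [mul_comm (A ^ _)]
    have := H x B A hB hA (fun j => (hx₂ j).trans_eq (by
      rw [mul_comm (A ^ _)]; congr 3 <;> ring)) (fun j => (hx₁ j).trans_eq (by
      rw [mul_comm (A ^ _)]; congr 3 <;> ring))
    rwa [sub_sub_cancel] at this
  set ρ : ℝ≥0∞ := 2 ^ (-(ε * D)) with hρ
  have hρ1 : ρ < 1 := ENNReal.rpow_lt_one_of_one_lt_of_neg (by norm_num) (by
    have := mul_pos hε hD0; linarith)
  have hρj : ∀ j : ℕ, (2 : ℝ≥0∞) ^ ((j : ℝ) * (-(ε * D))) = ρ ^ j := fun j => by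
    rw [hρ, mul_comm, ENNReal.rpow_mul, ENNReal.rpow_natCast]
  have hρj' : ∀ j : ℕ, (2 : ℝ≥0∞) ^ ((j : ℝ) * (ε * D)) = (ρ ^ j)⁻¹ := fun j => by
    rw [← hρj, ← ENNReal.rpow_neg]; congr 1; ring
  refine ⟨K * (2 * (1 - ρ)⁻¹), ENNReal.mul_ne_top hK (ENNReal.mul_ne_top (by simp)
    (ENNReal.inv_ne_top.2 (tsub_pos_of_lt hρ1).ne')), fun x A B hA hB hx₁ hx₂ => ?_⟩
  by_cases hA0 : A = 0
  · have : ∀ j, x j = 0 := fun j => by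
      have := hx₁ j
      rw [hA0, ENNReal.zero_rpow_of_pos (by linarith)] at this
      simpa using this
    simp [this]
  by_cases hB0 : B = 0
  · have : ∀ j, x j = 0 := fun j => by
      have := hx₁ j
      rw [hB0, ENNReal.zero_rpow_of_pos (by linarith)] at this
      simpa using this
    simp [this]
  have hA1 : A ^ ε ≠ 0 := (ENNReal.rpow_pos (pos_iff_ne_zero.2 hA0) hA).ne'
  have hB1 : B ^ ε ≠ 0 := (ENNReal.rpow_pos (pos_iff_ne_zero.2 hB0) hB).ne'
  have hA2 : A ^ ε ≠ ∞ := ENNReal.rpow_ne_top_of_nonneg hε.le hA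
  have hB2 : B ^ ε ≠ ∞ := ENNReal.rpow_ne_top_of_nonneg hε.le hB
  -- Relative to `K A^(1-θ) B^θ`, the two bounds are `y_j⁻¹` and `y_j` with `y_j = (B/A)^ε
  -- 2^{-jεD}`; `tsum_min_inv_le` is uniform in `y₀`, hence in `A` and `B`.
  set y₀ := B ^ ε * (A ^ ε)⁻¹ with hy
  have hy' : y₀ ≠ ∞ := ENNReal.mul_ne_top hB2 (ENNReal.inv_ne_top.2 hA1)
  have hyinv : ∀ j : ℕ, (y₀ * ρ ^ j)⁻¹ = A ^ ε * (B ^ ε)⁻¹ * (ρ ^ j)⁻¹ := fun j => by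
    rw [ENNReal.mul_inv (Or.inr (ENNReal.pow_ne_top hρ1.ne_top)) (Or.inl hy'), hy,
      ENNReal.mul_inv (Or.inl hB1) (Or.inl hB2), inv_inv, mul_comm (B ^ ε)⁻¹]
  have eA : ∀ u v : ℝ, A ^ (u + v) = A ^ u * A ^ v := fun u v => ENNReal.rpow_add _ _ hA0 hA
  have eB : ∀ u v : ℝ, B ^ (u + v) = B ^ u * B ^ v := fun u v => ENNReal.rpow_add _ _ hB0 hB
  have hx : ∀ j, x j ≤ K * (A ^ (1 - θ) * B ^ θ) * min (y₀ * ρ ^ j) (y₀ * ρ ^ j)⁻¹ := fun j => by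
    rw [mul_min]
    refine le_min ((hx₂ j).trans_eq ?_) ((hx₁ j).trans_eq ?_)
    · rw [hρj, show 1 - (θ + ε) = (1 - θ) + -ε by ring, eA, eB, ENNReal.rpow_neg, hy]
      ring
    · rw [hρj', hyinv, show 1 - (θ - ε) = (1 - θ) + ε by ring, sub_eq_add_neg θ ε, eA, eB,
        ENNReal.rpow_neg]
      ring
  calc ∑' j, x j ≤ ∑' j, K * (A ^ (1 - θ) * B ^ θ) * min (y₀ * ρ ^ j) (y₀ * ρ ^ j)⁻¹ :=
        ENNReal.tsum_le_tsum hx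
    _ = K * (A ^ (1 - θ) * B ^ θ) * ∑' j, min (y₀ * ρ ^ j) (y₀ * ρ ^ j)⁻¹ := ENNReal.tsum_mul_left
    _ ≤ K * (A ^ (1 - θ) * B ^ θ) * (2 * (1 - ρ)⁻¹) := by gcongr; exact tsum_min_inv_le hy' hρ1
    _ = _ := by ring

end Blocks

/-! ### Summation over frequencies and the eight cases. -/

/-- The interpolation inequality between Besov–Lorentz spaces, with some finite constant. -/
abbrev InterpolationInequality {n : ℕ} (ψ : ℕ → 𝓢(Rn n, ℂ)) (θ s s₁ s₂ : ℝ)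
    (p p₁ p₂ q q₁ q₂ r r₁ r₂ : ℝ≥0∞) : Prop :=
  ∃ C : ℝ≥0∞, C ≠ ∞ ∧
    ∀ f ∈ besovLorentzSpace ψ s₁ p₁ q₁ r₁ ∩ besovLorentzSpace ψ s₂ p₂ q₂ r₂,
      besovLorentzNorm ψ s p q r f ≤
        C * (besovLorentzNorm ψ s₁ p₁ q₁ r₁ f ^ (1 - θ) * besovLorentzNorm ψ s₂ p₂ q₂ r₂ f ^ θ)

end

theorem theorem4p1 (n : ℕ) (hn : 1 ≤ n)
    (s s₁ s₂ θ : ℝ) (hθ₀ : 0 < θ) (hθ₁ : θ < 1)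
    (p p₁ p₂ q q₁ q₂ r r₁ r₂ : ℝ≥0∞)
    (hp : 1 ≤ p) (hp₁ : 1 ≤ p₁) (hp₂ : 1 ≤ p₂)
    (hq : 1 ≤ q) (hq₁ : 1 ≤ q₁) (hq₂ : 1 ≤ q₂)
    (hr : 1 ≤ r) (hr₁ : 1 ≤ r₁) (hr₂ : 1 ≤ r₂)
    (hpq : p = ∞ → q = ∞) (hpq₁ : p₁ = ∞ → q₁ = ∞) (hpq₂ : p₂ = ∞ → q₂ = ∞)
    (ψ : ℕ → 𝓢(Rn n, ℂ)) (hψ : IsDyadicResolution ψ)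
    (sStar : ℝ) (hsStar : sStar = (1 - θ) * s₁ + θ * s₂)
    (pStar qStar rStar : ℝ≥0∞) (hpStar : pStar = interpExp θ p₁ p₂)
    (hqStar : qStar = interpExp θ q₁ q₂) (hrStar : rStar = interpExp θ r₁ r₂)
    (hmain : dimOver n pStar - dimOver n p ≤ sStar - s)
    (hmain₀ : 0 ≤ dimOver n pStar - dimOver n p)
    (hcond :
      -- (i)
      (qStar ≤ q ∧ rStar ≤ r) ∨
      -- (ii)
      (pStar = p ∧ p₁ ≠ p₂ ∧ rStar ≤ r) ∨
      -- (iii)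
      (pStar < p ∧ rStar ≤ r) ∨
      -- (iv)
      (s₁ ≠ s₂ ∧ p = p₁ ∧ p₁ = p₂ ∧ max q₁ q₂ ≤ q) ∨
      -- (v)
      (s < sStar ∧ pStar = p ∧ qStar ≤ q) ∨
      -- (vi)
      (s < sStar ∧ pStar = p ∧ p₁ ≠ p₂) ∨
      -- (vii)
      (dimOver n pStar - dimOver n p < sStar - s ∧ 0 < dimOver n pStar - dimOver n p) ∨
      -- (viii)
      (sStar - s = dimOver n pStar - dimOver n p ∧ 0 < dimOver n pStar - dimOver n p ∧
        s₂ - s₁ ≠ dimOver n p₂ - dimOver n p₁)) :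
    ∃ C : NNReal, ∀ f ∈ besovLorentzSpace ψ s₁ p₁ q₁ r₁ ∩ besovLorentzSpace ψ s₂ p₂ q₂ r₂,
      besovLorentzNorm ψ s p q r f ≤
        C * besovLorentzNorm ψ s₁ p₁ q₁ r₁ f ^ (1 - θ) * besovLorentzNorm ψ s₂ p₂ q₂ r₂ f ^ θ := by
  subst hpStar hqStar hrStar hsStar
  have hps := one_le_interpExp hθ₀.le hθ₁.le hp₁ hp₂
  have hts := interpExp_inv_toReal hθ₀.le hθ₁.le hp₁ hp₂
  have hn0 : (0 : ℝ) < n := by exact_mod_cast hn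
  simp only [dimOver] at hmain hmain₀ hcond
  have hle : interpExp θ p₁ p₂ ≤ p := by
    by_contra h
    have := (toReal_inv_lt hps hp).2 (not_le.1 h)
    nlinarith
  have hlt : 0 < n * ((interpExp θ p₁ p₂)⁻¹).toReal - n * (p⁻¹).toReal → interpExp θ p₁ p₂ < p :=
    fun h => (toReal_inv_lt hp hps).1 (by nlinarith)
  suffices H : InterpolationInequality ψ θ s s₁ s₂ p p₁ p₂ q q₁ q₂ r r₁ r₂ by
    obtain ⟨C, hC, H⟩ := H
    refine ⟨C.toNNReal, fun f hf => ?_⟩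
    rw [ENNReal.coe_toNNReal hC, mul_assoc]
    exact H f hf
  set e := (s - n * (p⁻¹).toReal) -
    ((1 - θ) * (s₁ - n * (p₁⁻¹).toReal) + θ * (s₂ - n * (p₂⁻¹).toReal)) with he
  have he' : e = (n * ((interpExp θ p₁ p₂)⁻¹).toReal - n * (p⁻¹).toReal) -
      ((1 - θ) * s₁ + θ * s₂ - s) := by rw [he, hts]; ring
  have he0 : e ≤ 0 := by rw [he']; linarith
  have caseSame : BlockCondition θ p p₁ p₂ q q₁ q₂ → interpExp θ r₁ r₂ ≤ r →
      InterpolationInequality ψ θ s s₁ s₂ p p₁ p₂ q q₁ q₂ r r₁ r₂ := fun hb hrr => by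
    obtain ⟨C, hC, H⟩ := exists_weightedPiece_bound hψ hθ₀ hθ₁ s s₁ s₂ hp hp₁ hp₂ hq hq₁ hq₂ hr₁ hr₂
      hpq hpq₁ hpq₂ hb
    refine ⟨C, hC, fun f hf => ?_⟩
    have hrs := one_le_interpExp hθ₀.le hθ₁.le hr₁ hr₂
    calc seqNorm r (weightedPiece ψ s p q f)
        ≤ seqNorm (interpExp θ r₁ r₂) (weightedPiece ψ s p q f) := seqNorm_le_of_le hrs hrr _
      _ ≤ seqNorm (interpExp θ r₁ r₂) fun j => C * (weightedPiece ψ s₁ p₁ q₁ f j ^ (1 - θ) *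
            weightedPiece ψ s₂ p₂ q₂ f j ^ θ) := by
          refine seqNorm_mono _ fun j => (H f hf j).trans ?_
          gcongr
          refine mul_le_of_le_one_right' ?_
          calc (2 : ℝ≥0∞) ^ ((j : ℝ) * e) ≤ 2 ^ (0 : ℝ) :=
                ENNReal.rpow_le_rpow_of_exponent_le (by norm_num)
                  (mul_nonpos_of_nonneg_of_nonpos (by positivity) he0)
            _ = 1 := ENNReal.rpow_zero
      _ = C * seqNorm (interpExp θ r₁ r₂) fun j => weightedPiece ψ s₁ p₁ q₁ f j ^ (1 - θ) *
            weightedPiece ψ s₂ p₂ q₂ f j ^ θ := seqNorm_const_mul hrs hC _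
      _ ≤ _ := by
          gcongr
          exact seqNorm_interp hθ₀ hθ₁ hr₁ hr₂ fun j => le_rfl
  have caseGain : BlockCondition θ p p₁ p₂ q q₁ q₂ → e < 0 →
      InterpolationInequality ψ θ s s₁ s₂ p p₁ p₂ q q₁ q₂ r r₁ r₂ := fun hb hneg => by
    obtain ⟨C, hC, H⟩ := exists_weightedPiece_bound hψ hθ₀ hθ₁ s s₁ s₂ hp hp₁ hp₂ hq hq₁ hq₂ hr₁ hr₂
      hpq hpq₁ hpq₂ hb
    have hρ : (2 : ℝ≥0∞) ^ e < 1 := ENNReal.rpow_lt_one_of_one_lt_of_neg (by norm_num) hneg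
    refine ⟨C * (1 - 2 ^ e)⁻¹, ENNReal.mul_ne_top hC
      (ENNReal.inv_ne_top.2 (tsub_pos_of_lt hρ).ne'), fun f hf => ?_⟩
    refine (seqNorm_le_tsum hr _).trans ?_
    calc ∑' j, weightedPiece ψ s p q f j
        ≤ ∑' j : ℕ, C * (besovLorentzNorm ψ s₁ p₁ q₁ r₁ f ^ (1 - θ) *
            besovLorentzNorm ψ s₂ p₂ q₂ r₂ f ^ θ) * (2 ^ e) ^ j := by
          refine ENNReal.tsum_le_tsum fun j => (H f hf j).trans ?_
          rw [mul_comm (j : ℝ), ENNReal.rpow_mul, ENNReal.rpow_natCast, mul_right_comm]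
          gcongr
          · exact weightedPiece_le hr₁ f j
          · exact weightedPiece_le hr₂ f j
      _ = _ := by rw [ENNReal.tsum_mul_left, ENNReal.tsum_geometric]; ring
  -- At `θ ∓ ε` the exponent of `2^j` is `e ± εD` with `D` the nonzero difference below; since `e ≤
  -- 0`, it may be replaced by `±εD`.
  have caseSplit : ∀ ε, 0 < ε → ε < θ → θ + ε < 1 → BlockCondition (θ - ε) p p₁ p₂ q q₁ q₂ →
      BlockCondition (θ + ε) p p₁ p₂ q q₁ q₂ →
      (s₂ - n * (p₂⁻¹).toReal) - (s₁ - n * (p₁⁻¹).toReal) ≠ 0 →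
      InterpolationInequality ψ θ s s₁ s₂ p p₁ p₂ q q₁ q₂ r r₁ r₂ :=
    fun ε hε hε₀ hε₁ hb hb' hD => by
    obtain ⟨C, hC, H⟩ := exists_weightedPiece_bound hψ (by linarith) (by linarith) s s₁ s₂ hp hp₁ hp₂
      hq hq₁ hq₂ hr₁ hr₂ hpq hpq₁ hpq₂ hb
    obtain ⟨C', hC', H'⟩ := exists_weightedPiece_bound hψ (by linarith) (by linarith) s s₁ s₂ hp hp₁
      hp₂ hq hq₁ hq₂ hr₁ hr₂ hpq hpq₁ hpq₂ hb'
    obtain ⟨L, hL, HL⟩ := exists_tsum_le_interp hε hε₀ hε₁ hD (ENNReal.add_ne_top.2 ⟨hC, hC'⟩)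
    refine ⟨L, hL, fun f hf => (seqNorm_le_tsum hr _).trans (HL _ _ _ hf.1.ne hf.2.ne
      (fun j => (H f hf j).trans ?_) fun j => (H' f hf j).trans ?_)⟩
    · gcongr
      · exact le_self_add
      · norm_num
      · rw [he] at he0
        nlinarith
      · linarith
      · exact weightedPiece_le hr₁ f j
      · exact weightedPiece_le hr₂ f j
    · gcongr
      · exact le_add_self
      · norm_num
      · rw [he] at he0
        nlinarith
      · exact weightedPiece_le hr₁ f j
      · exact weightedPiece_le hr₂ f j
  rcases hcond with ⟨hqq, hrr⟩ | ⟨hpp, hne, hrr⟩ | ⟨hpp, hrr⟩ | ⟨hs, rfl, rfl, hqq⟩ | ⟨hs, hpp, hqq⟩ |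
    ⟨hs, hpp, hne⟩ | ⟨hs, hpp⟩ | ⟨_, hpp, hD⟩
  -- When `p_* < p` Nikolskii needs nothing about `q`; the hypothesis on `q_*` serves only the
  -- equality case.
  · exact caseSame (hle.lt_or_eq.imp_right fun h => ⟨h, Or.inr hqq⟩) hrr
  · exact caseSame (Or.inr ⟨hpp, Or.inl hne⟩) hrr
  · exact caseSame (Or.inl hpp) hrr
  -- With `p₁ = p₂ = p` the intermediate `p` stays fixed while the intermediate `q` varies with `φ`;
  -- `max q₁ q₂ ≤ q` covers all of them at once. Here `D = s₂ - s₁`.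
  · have hb : ∀ φ, 0 ≤ φ → φ ≤ 1 → BlockCondition φ p p p q q₁ q₂ := fun φ h h' =>
      Or.inr ⟨interpExp_self h h' p, Or.inr ((interpExp_le_max h h' q₁ q₂).trans hqq)⟩
    have h1 : min θ (1 - θ) ≤ θ := min_le_left _ _
    have h2 : min θ (1 - θ) ≤ 1 - θ := min_le_right _ _
    have h3 : 0 < min θ (1 - θ) := lt_min hθ₀ (by linarith)
    refine caseSplit (min θ (1 - θ) / 2) (by linarith) (by linarith) (by linarith)
      (hb _ (by linarith) (by linarith)) (hb _ (by linarith) (by linarith)) ?_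
    intro h
    exact hs (by linarith)
  · refine caseGain (Or.inr ⟨hpp, Or.inr hqq⟩) ?_
    rw [he', hpp]; linarith
  · refine caseGain (Or.inr ⟨hpp, Or.inl hne⟩) ?_
    rw [he', hpp]; linarith
  · refine caseGain (Or.inl (hlt hpp)) ?_
    rw [he']; linarith
  · have ht := (toReal_inv_lt hp hps).2 (hlt hpp)
    rw [hts] at ht
    -- `δ` is the room in `1/p < 1/p_*`. As each `1/pᵢ` lies in `[0, 1]`, changing `θ` by `ε` moves
    -- `1/p_*` by at most `ε < δ`, so the strict inequality persists at `θ ± ε`.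
    set δ := (1 - θ) * (p₁⁻¹).toReal + θ * (p₂⁻¹).toReal - (p⁻¹).toReal with hδ
    have hδ0 : 0 < δ := by rw [hδ]; linarith
    have inv_le_one : ∀ a : ℝ≥0∞, 1 ≤ a → (a⁻¹).toReal ≤ 1 := fun a ha => by
      simpa using ENNReal.toReal_mono (by simp) (ENNReal.inv_le_one.2 ha)
    have b₁ := inv_le_one p₁ hp₁
    have b₂ := inv_le_one p₂ hp₂
    have c₁ : 0 ≤ (p₁⁻¹).toReal := ENNReal.toReal_nonneg
    have c₂ : 0 ≤ (p₂⁻¹).toReal := ENNReal.toReal_nonneg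
    have h1 : min (min θ (1 - θ)) δ ≤ θ := (min_le_left _ _).trans (min_le_left _ _)
    have h2 : min (min θ (1 - θ)) δ ≤ 1 - θ := (min_le_left _ _).trans (min_le_right _ _)
    have h3 : min (min θ (1 - θ)) δ ≤ δ := min_le_right _ _
    have h4 : 0 < min (min θ (1 - θ)) δ := lt_min (lt_min hθ₀ (by linarith)) hδ0
    set ε := min (min θ (1 - θ)) δ / 2 with hε
    have hε0 : 0 < ε := by linarith
    have hεδ : ε < δ := by linarith
    refine caseSplit ε hε0 (by linarith) (by linarith) (Or.inl ?_) (Or.inl ?_) ?_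
    · have h : 0 ≤ θ - ε := by linarith
      have h' : θ - ε ≤ 1 := by linarith
      rw [← toReal_inv_lt hp (one_le_interpExp h h' hp₁ hp₂), interpExp_inv_toReal h h' hp₁ hp₂]
      nlinarith
    · have h : 0 ≤ θ + ε := by linarith
      have h' : θ + ε ≤ 1 := by linarith
      rw [← toReal_inv_lt hp (one_le_interpExp h h' hp₁ hp₂), interpExp_inv_toReal h h' hp₁ hp₂]
      nlinarith
    · intro h
      exact hD (by linarith)
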